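/- Let $W=\mathbb{C}^{2n}=\{(u,v):u,v\in\mathbb{C}^n\}$ with its standard Hermitian scalar product and the symmetric bilinear (CAR) bracket $\{(u,v),(u',v')\}=\sum_i(u_iv'_i+v_iu'_i)$, and let $j_1,\dots,j_s$ ($s\ge 0$) be unitary operators on $W$ which preserve the bracket and satisfy $j_lj_m+j_mj_l=-2\delta_{lm}\mathrm{Id}$. Equip $\mathbb{C}^2\otimes W=W\oplus W$ with the orthogonal-sum scalar product and bracket and put $$J_l=\begin{pmatrix}0&1\\1&0\end{pmatrix}\otimes j_l,\qquad I=\begin{pmatrix}0&1\\-1&0\end{pmatrix}\otimes\mathrm{Id}_W,\qquad K=\begin{pmatrix}\mathrm{i}&0\\0&-\mathrm{i}\end{pmatrix}\otimes\mathrm{Id}_W .$$ For a complex subspace $A\subset\mathbb{C}^2\otimes W$ let $A^{\mathrm c}$ be its Hermitian orthogonal complement, $A^\perp$ its annihilator with respect to the bracket, and $J(A)=\mathrm{i}(\Pi_A-\Pi_{A^{\mathrm c}})$, where $\Pi$ denotes orthogonal projection. Let $E_{\pm\mathrm{i}}(K)$ be the eigenspaces of $K$ and define $$\beta_t(A)=\mathrm{e}^{(t\pi/2)KJ(A)}\cdot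 E_{+\mathrm{i}}(K).$$ Consider the following spaces of subspaces (as subspaces of the union of the Grassmannians of $\mathbb{C}^2\otimes W$): \begin{align*} C_s(2n)&=\{A: J_1A=\dots=J_sA=A^{\mathrm c}\}, & C_{s+1}(2n)&=\{A\in C_s(2n): IA=A^{\mathrm c}\},\\ R_{s+1}(2n)&=\{A\in C_{s+1}(2n): A=A^\perp\}, & R_{s+1,1}(2n)&=\{A\in R_{s+1}(2n): KA=A^{\mathrm c}\},\\ \widetilde R_{s,1}(2n)&=\{A\in C_s(2n): IA^{\mathrm c}=A=IK A^\perp\}. && \end{align*} Fix a base point $A_\ast\in R_{s+1,1}(2n)$. Let $C$, $\widetilde R_{s,1}$, $R_{s+1,1}$ be the connected components of $C_{s+1}(2n)$, $\widetilde R_{s,1}(2n)$, $R_{s+1,1}(2n)$ containing $A_\ast$, and let $R_{s+1}=R_{s+1}(2n)\cap C$. Let $$U=\{u\in\mathrm{U}(\mathbb{C}^2\otimes W): u=IuI^{-1}=J_1uJ_1^{-1}=\dots=J_suJ_s^{-1}\},$$ and for $u\in U$ put $\tau_{\mathrm{car}}(u)=(u^{-1})^T$ (transpose with respect to the bracket),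 $\theta(u)=IKu(IK)^{-1}$ and $\widetilde\tau_{\mathrm{car}}=\theta\circ\tau_{\mathrm{car}}$. Suppose that the bundle $U\to C$, $u\mapsto u\cdot E_{+\mathrm{i}}(K)$, admits a global section, i.e. a continuous map $\sigma:C\to U$ with $\sigma(A)\cdot E_{+\mathrm{i}}(K)=A$ for all $A\in C$, such that (i) for all $A,A'\in C$ the elements $\sigma(A)$ and $\tau_{\mathrm{car}}(\sigma(A))$ commute with $\theta(\sigma(A'))$ and $\widetilde\tau_{\mathrm{car}}(\sigma(A'))$; (ii) $\tau_{\mathrm{car}}(\sigma(A))=\sigma(A)^{-1}$ for all $A\in\widetilde R_{s,1}$. Then $p(A)=\tau_{\mathrm{car}}(\sigma(A))^{-1}\cdot A$ defines a mapping $p:C\to C$ with the following properties. 1. The image of $p$ is $\widetilde R_{s,1}$. 2. For all $A\in R_{s+1,1}$ and all $t\in\mathbb{R}$ one has $\beta_t(A)\in C$ and $p(\beta_t(A))=\beta_{2t}(A)$. 3. $p(R_{s+1})=\{E_{-\mathrm{i}}(K)\}$. 4. $p:C\to\widetilde R_{s,1}$ has the homotopy lifting property: for every topological space $M$ and all continuous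 maps $f:M\times[0,1]\to\widetilde R_{s,1}$ and $F_0:M\to C$ with $p\circ F_0=f(\cdot,0)$ there is a continuous map $F:M\times[0,1]\to C$ with $p\circ F=f$ and $F(\cdot,0)=F_0$. -/

import Mathlib

open scoped Kronecker

noncomputable section

namespace DiagMap

/-! ### The spaces `W = ℂ²ⁿ` and `ℂ² ⊗ W` -/

/-- Index set of the standard basis of `W = ℂ²ⁿ = U ⊕ V`: `inl i` labels the annihilation
operators (coefficients `u_i`), `inr i` the creation operators (coefficients `v_i`). -/
abbrev WIdx (n : ℕ) : Type := Fin n ⊕ Fin n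

/-- Index set of the standard basis of the doubled space `ℂ² ⊗ W`. -/
abbrev DIdx (n : ℕ) : Type := Fin 2 × WIdx n

/-- The doubled space `ℂ² ⊗ W` with its Hermitian scalar product. -/
abbrev DSpace (n : ℕ) : Type := EuclideanSpace ℂ (DIdx n)

/-- Complex linear operators on `ℂ² ⊗ W`. -/
abbrev Op (n : ℕ) : Type := Matrix (DIdx n) (DIdx n) ℂ

/-- The unitary group `U(ℂ² ⊗ W)`. -/
abbrev UGrp (n : ℕ) : Type := Matrix.unitaryGroup (DIdx n) ℂ

/-- The CAR bracket of `W`: `{ψ, ψ'} = ∑ᵢ (uᵢ v'ᵢ + vᵢ u'ᵢ)`. -/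
def carW {n : ℕ} (ψ ψ' : WIdx n → ℂ) : ℂ :=
  ∑ i : Fin n, (ψ (Sum.inl i) * ψ' (Sum.inr i) + ψ (Sum.inr i) * ψ' (Sum.inl i))

/-- The CAR bracket of `ℂ² ⊗ W = W₊ ⊕ W₋`, the sum of the brackets of the two copies of `W`. -/
def car {n : ℕ} (v w : DIdx n → ℂ) : ℂ :=
  ∑ e : Fin 2, carW (fun a => v (e, a)) (fun a => w (e, a))

/-- Real Clifford generators `j₁, …, j_s` on `W`: unitary operators which preserve the CAR bracket
and satisfy `j_l j_m + j_m j_l = - 2 δ_{lm} Id`. -/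
structure IsRealClifford {n s : ℕ} (j : Fin s → Matrix.unitaryGroup (WIdx n) ℂ) : Prop where
  real : ∀ (l : Fin s) (ψ ψ' : WIdx n → ℂ),
    carW ((j l).1.mulVec ψ) ((j l).1.mulVec ψ') = carW ψ ψ'
  clifford : ∀ l m : Fin s,
    (j l).1 * (j m).1 + (j m).1 * (j l).1 = if l = m then (-2 : ℂ) • 1 else 0

/-! ### The extended Clifford generators `J₁, …, J_s, I, K` on `ℂ² ⊗ W` -/

lemma sigmaX_mem : (!![0, 1; 1, 0] : Matrix (Fin 2) (Fin 2) ℂ) ∈ unitary _ := by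
  constructor <;> ext a b <;> fin_cases a <;> fin_cases b <;>
    simp [Matrix.mul_apply, Matrix.star_apply, Fin.sum_univ_two]

lemma epsilon_mem : (!![0, 1; -1, 0] : Matrix (Fin 2) (Fin 2) ℂ) ∈ unitary _ := by
  constructor <;> ext a b <;> fin_cases a <;> fin_cases b <;>
    simp [Matrix.mul_apply, Matrix.star_apply, Fin.sum_univ_two]

lemma iSigmaZ_mem :
    (!![Complex.I, 0; 0, -Complex.I] : Matrix (Fin 2) (Fin 2) ℂ) ∈ unitary _ := by
  constructor <;> ext a b <;> fin_cases a <;> fin_cases b <;>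
    simp [Matrix.mul_apply, Matrix.star_apply, Fin.sum_univ_two]

/-- `J_l = (0 1; 1 0) ⊗ j_l`. -/
def genJ {n s : ℕ} (j : Fin s → Matrix.unitaryGroup (WIdx n) ℂ) (l : Fin s) : UGrp n :=
  ⟨!![0, 1; 1, 0] ⊗ₖ (j l).1, Matrix.kronecker_mem_unitary sigmaX_mem (j l).2⟩

/-- `I = (0 1; -1 0) ⊗ Id`. -/
def genI (n : ℕ) : UGrp n :=
  ⟨!![0, 1; -1, 0] ⊗ₖ (1 : Matrix (WIdx n) (WIdx n) ℂ),
    Matrix.kronecker_mem_unitary epsilon_mem (one_mem _)⟩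

/-- `K = (i 0; 0 -i) ⊗ Id`. -/
def genK (n : ℕ) : UGrp n :=
  ⟨!![Complex.I, 0; 0, -Complex.I] ⊗ₖ (1 : Matrix (WIdx n) (WIdx n) ℂ),
    Matrix.kronecker_mem_unitary iSigmaZ_mem (one_mem _)⟩

/-! ### Complex planes in `ℂ² ⊗ W` -/

/-- Complex planes (of any dimension) in `ℂ² ⊗ W`. -/
abbrev Plane (n : ℕ) : Type := Submodule ℂ (DSpace n)

/-- The orthogonal projection `Π_A`, as a matrix. -/
def proj {n : ℕ} (A : Plane n) : Op n :=
  (Matrix.toEuclideanCLM (n := DIdx n) (𝕜 := ℂ)).symm A.starProjection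

/-- The usual topology on the (disjoint union of the) Grassmannians of `ℂ² ⊗ W`: planes are
identified with their orthogonal projections. -/
instance planeTopology (n : ℕ) : TopologicalSpace (Plane n) :=
  TopologicalSpace.induced proj inferInstance

/-- The image plane `X · A`. -/
def act {n : ℕ} (X : Op n) (A : Plane n) : Plane n :=
  A.map (Matrix.toEuclideanLin X)

/-- The Hermitian orthogonal complement `Aᶜ`. -/
def compl {n : ℕ} (A : Plane n) : Plane n := Aᗮ

/-- The annihilator `A^⊥` of `A` with respect to the CAR bracket. -/
def perp {n : ℕ} (A : Plane n) : Plane n where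
  carrier := {v | ∀ w ∈ A, car v.ofLp w.ofLp = 0}
  add_mem' := by
    intro a b ha hb w hw
    have h1 := ha w hw
    have h2 := hb w hw
    have : car (a + b).ofLp w.ofLp = car a.ofLp w.ofLp + car b.ofLp w.ofLp := by
      simp only [car, carW, PiLp.add_apply, add_mul, ← Finset.sum_add_distrib]
      refine Finset.sum_congr rfl fun e _ => Finset.sum_congr rfl fun i _ => ?_
      ring
    rw [this, h1, h2, add_zero]
  zero_mem' := by
    intro w _
    simp [car, carW]
  smul_mem' := by
    intro c a ha w hw
    have h1 := ha w hw
    have : car (c • a).ofLp w.ofLp = c * car a.ofLp w.ofLp := by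
      simp only [car, carW, PiLp.smul_apply, smul_eq_mul, Finset.mul_sum]
      refine Finset.sum_congr rfl fun e _ => Finset.sum_congr rfl fun i _ => ?_
      ring
    rw [this, h1, mul_zero]

/-- The eigenspace `E_{+i}(K)`. -/
def Eplus (n : ℕ) : Plane n :=
  Module.End.eigenspace (Matrix.toEuclideanLin (genK n).1) Complex.I

/-- The eigenspace `E_{-i}(K)`. -/
def Eminus (n : ℕ) : Plane n :=
  Module.End.eigenspace (Matrix.toEuclideanLin (genK n).1) (-Complex.I)

/-- `J(A) = i (Π_A - Π_{Aᶜ})`. -/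
def JOp {n : ℕ} (A : Plane n) : Op n := Complex.I • (proj A - proj (compl A))

/-- The curve `β_t(A) = e^{(t π / 2) K J(A)} · E_{+i}(K)`. -/
def beta {n : ℕ} (t : ℝ) (A : Plane n) : Plane n :=
  act (NormedSpace.exp (((t * Real.pi / 2 : ℝ) : ℂ) • ((genK n).1 * JOp A))) (Eplus n)

/-! ### The CAR transpose and the involutions `τ_car`, `θ`, `τ̃_car` -/

/-- Gram matrix of the CAR bracket of `ℂ² ⊗ W` in the standard basis. -/
def gram (n : ℕ) : Op n :=
  (1 : Matrix (Fin 2) (Fin 2) ℂ) ⊗ₖ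
    (Matrix.fromBlocks 0 1 1 0 : Matrix (WIdx n) (WIdx n) ℂ)

/-- The transpose `Xᵀ` with respect to the CAR bracket; see `car_carTranspose`. -/
def carTranspose {n : ℕ} (X : Op n) : Op n := gram n * X.transpose * gram n

lemma gram_mul_gram (n : ℕ) : gram n * gram n = 1 := by
  rw [gram, ← Matrix.mul_kronecker_mul, Matrix.fromBlocks_multiply]
  simp [Matrix.fromBlocks_one]

lemma gram_transpose (n : ℕ) : (gram n).transpose = gram n := by
  rw [gram, ← Matrix.kroneckerMap_transpose, Matrix.fromBlocks_transpose]
  simp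

lemma gram_star (n : ℕ) : star (gram n) = gram n := by
  rw [gram, Matrix.star_eq_conjTranspose, Matrix.conjTranspose_kronecker,
    Matrix.fromBlocks_conjTranspose]
  simp

lemma car_eq_gram {n : ℕ} (v w : DIdx n → ℂ) : car v w = v ⬝ᵥ (gram n).mulVec w := by
  simp only [car, carW, gram, dotProduct, Matrix.mulVec, Fintype.sum_prod_type,
    Fintype.sum_sum_type, Matrix.kroneckerMap_apply, Matrix.one_apply]
  simp [Finset.sum_add_distrib, Matrix.one_apply]

/-- The defining property `{Xᵀ v, w} = {v, X w}` of the CAR transpose. -/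
lemma car_carTranspose {n : ℕ} (X : Op n) (v w : DIdx n → ℂ) :
    car ((carTranspose X).mulVec v) w = car v (X.mulVec w) := by
  rw [car_eq_gram, car_eq_gram, Matrix.dotProduct_mulVec, ← Matrix.mulVec_transpose,
    Matrix.mulVec_mulVec, gram_transpose, carTranspose, ← Matrix.mul_assoc, ← Matrix.mul_assoc,
    gram_mul_gram, Matrix.one_mul, ← Matrix.mulVec_mulVec, Matrix.mulVec_transpose,
    ← Matrix.dotProduct_mulVec, Matrix.dotProduct_mulVec v, ← Matrix.mulVec_transpose,
    gram_transpose]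

lemma carTranspose_mul {n : ℕ} (X Y : Op n) :
    carTranspose (X * Y) = carTranspose Y * carTranspose X := by
  simp only [carTranspose, Matrix.transpose_mul, Matrix.mul_assoc]
  rw [← Matrix.mul_assoc (gram n) (gram n), gram_mul_gram, Matrix.one_mul]

lemma carTranspose_one {n : ℕ} : carTranspose (1 : Op n) = 1 := by
  simp [carTranspose, gram_mul_gram]

lemma star_carTranspose {n : ℕ} (X : Op n) :
    star (carTranspose X) = carTranspose (star X) := by
  simp only [carTranspose, star_mul, gram_star, Matrix.mul_assoc]
  rfl

lemma carTranspose_mem {n : ℕ} {X : Op n} (hX : X ∈ Matrix.unitaryGroup (DIdx n) ℂ) :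
    carTranspose X ∈ Matrix.unitaryGroup (DIdx n) ℂ := by
  constructor
  · rw [star_carTranspose, ← carTranspose_mul, hX.2, carTranspose_one]
  · rw [star_carTranspose, ← carTranspose_mul, hX.1, carTranspose_one]

/-- The automorphism `τ_car(g) = (g⁻¹)ᵀ` of the unitary group. -/
def tauCar (n : ℕ) : UGrp n →* UGrp n where
  toFun g := ⟨carTranspose (g⁻¹).1, carTranspose_mem (g⁻¹).2⟩
  map_one' := by
    apply Subtype.ext
    simp [carTranspose_one]
  map_mul' g h := by
    apply Subtype.ext
    simp only [mul_inv_rev, Submonoid.coe_mul, carTranspose_mul]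

/-- The Cartan involution `θ(u) = I K u (I K)⁻¹`. -/
def theta (n : ℕ) : UGrp n →* UGrp n :=
  (MulAut.conj (genI n * genK n)).toMonoidHom

/-- The modified involution `τ̃_car = θ ∘ τ_car`. -/
def tauCarTilde (n : ℕ) : UGrp n →* UGrp n := (theta n).comp (tauCar n)

/-! ### The classifying spaces -/

/-- The involution `τ̃_{s+1}(A) = I K A^⊥`. -/
def tauTilde {n : ℕ} (A : Plane n) : Plane n := act (genI n * genK n).1 (perp A)

section Spaces

variable {n s : ℕ} (j : Fin s → Matrix.unitaryGroup (WIdx n) ℂ)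

/-- `C_s(2n)`: planes with `J₁ A = … = J_s A = Aᶜ`. -/
def Cs : Set (Plane n) := {A | ∀ l, act (genJ j l).1 A = compl A}

/-- `C_{s+1}(2n)`. -/
def Cs1 : Set (Plane n) := {A | A ∈ Cs j ∧ act (genI n).1 A = compl A}

/-- `C_{s+2}(2n)`. -/
def Cs2 : Set (Plane n) := {A | A ∈ Cs1 j ∧ act (genK n).1 A = compl A}

/-- `R_{s+1}(2n)`. -/
def Rs1 : Set (Plane n) := {A | A ∈ Cs1 j ∧ perp A = A}

/-- `R_{s+1,1}(2n)`. -/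
def Rs11 : Set (Plane n) := {A | A ∈ Cs2 j ∧ perp A = A}

/-- `R̃_{s,1}(2n)`: planes of `C_s(2n)` with `I Aᶜ = A = τ̃_{s+1}(A)`. -/
def RtildeFull : Set (Plane n) := {A | A ∈ Cs j ∧ act (genI n).1 (compl A) = A ∧ tauTilde A = A}

/-- `C`, the connected component of `C_{s+1}(2n)` containing the base point `A₀`. -/
def C (A₀ : Plane n) : Set (Plane n) := connectedComponentIn (Cs1 j) A₀

/-- `R_{s+1} = R_{s+1}(2n) ∩ C`. -/
def R (A₀ : Plane n) : Set (Plane n) := Rs1 j ∩ C j A₀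

/-- `R̃_{s,1}`, the connected component of `R̃_{s,1}(2n)` containing the base point. -/
def Rtilde (A₀ : Plane n) : Set (Plane n) := connectedComponentIn (RtildeFull j) A₀

/-- `R_{s+1,1}`, the connected component of `R_{s+1,1}(2n)` containing the base point. -/
def R11 (A₀ : Plane n) : Set (Plane n) := connectedComponentIn (Rs11 j) A₀

/-- The symmetry group `U` of all unitary `u` with `u = I u I⁻¹ = J₁ u J₁⁻¹ = … = J_s u J_s⁻¹`. -/
def U : Subgroup (UGrp n) where
  carrier := {u | genI n * u * (genI n)⁻¹ = u ∧ ∀ l, genJ j l * u * (genJ j l)⁻¹ = u}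
  mul_mem' := by
    rintro a b ⟨ha, ha'⟩ ⟨hb, hb'⟩
    refine ⟨?_, fun l => ?_⟩
    · calc _ = (genI n * a * (genI n)⁻¹) * (genI n * b * (genI n)⁻¹) := by group
        _ = a * b := by rw [ha, hb]
    · calc _ = (genJ j l * a * (genJ j l)⁻¹) * (genJ j l * b * (genJ j l)⁻¹) := by group
        _ = a * b := by rw [ha', hb']
  one_mem' := ⟨by group, fun l => by group⟩
  inv_mem' := by
    rintro a ⟨ha, ha'⟩
    refine ⟨?_, fun l => ?_⟩
    · calc _ = (genI n * a * (genI n)⁻¹)⁻¹ := by group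
        _ = a⁻¹ := by rw [ha]
    · calc _ = (genJ j l * a * (genJ j l)⁻¹)⁻¹ := by group
        _ = a⁻¹ := by rw [ha' l]

variable {j} {A₀ : Plane n}

/-- `σ` is a global section of the bundle `U → C`, `u ↦ u · E_{+i}(K)`. -/
def IsSection (σ : C(C j A₀, U j)) : Prop :=
  ∀ A : C j A₀, act (σ A).1.1 (Eplus n) = A.1

/-- Condition (i): `σ(A)` and `τ_car(σ(A))` commute with `θ(σ(A'))` and `τ̃_car(σ(A'))`. -/
def SectionCommutes (σ : C(C j A₀, U j)) : Prop :=
  ∀ A A' : C j A₀,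
    Commute (σ A).1 (theta n (σ A').1) ∧
    Commute (σ A).1 (tauCarTilde n (σ A').1) ∧
    Commute (tauCar n (σ A).1) (theta n (σ A').1) ∧
    Commute (tauCar n (σ A).1) (tauCarTilde n (σ A').1)

/-- Condition (ii): `τ_car(σ(A)) = σ(A)⁻¹` for all `A` in `R̃_{s,1}`. -/
def SectionInverts (σ : C(C j A₀, U j)) : Prop :=
  ∀ A : C j A₀, A.1 ∈ Rtilde j A₀ → tauCar n (σ A).1 = ((σ A).1)⁻¹

/-- The mapping `p(A) = τ_car(σ(A))⁻¹ · A`. -/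
def p (σ : C(C j A₀, U j)) (A : C j A₀) : Plane n :=
  act ((tauCar n (σ A).1)⁻¹).1 A.1

end Spaces

end DiagMap

end

noncomputable section

namespace DiagMap

section Planes

variable {n : ℕ}

lemma toEuclideanLin_proj (A : Plane n) (v : DSpace n) :
    Matrix.toEuclideanLin (proj A) v = A.starProjection v := by
  have h : Matrix.toEuclideanCLM (n := DIdx n) (𝕜 := ℂ) (proj A) = A.starProjection := by
    simp [proj]
  rw [← h]; rfl

lemma toEuclideanLin_mul_apply (X Y : Op n) (v : DSpace n) :
    Matrix.toEuclideanLin (X * Y) v =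
      Matrix.toEuclideanLin X (Matrix.toEuclideanLin Y v) := by
  simp

lemma toEuclideanLin_one_apply (v : DSpace n) :
    Matrix.toEuclideanLin (1 : Op n) v = v := by
  simp

lemma inner_toEuclideanLin (X : Op n) (v w : DSpace n) :
    inner ℂ (Matrix.toEuclideanLin X v) w = inner ℂ v (Matrix.toEuclideanLin (star X) w) := by
  rw [Matrix.star_eq_conjTranspose, Matrix.toEuclideanLin_conjTranspose_eq_adjoint,
    LinearMap.adjoint_inner_right]

/-- A matrix is the orthogonal projection onto `A` as soon as it maps into `A` and its residuals
are orthogonal to `A`. -/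
lemma proj_eq_of {A : Plane n} {P : Op n} (h₁ : ∀ v, Matrix.toEuclideanLin P v ∈ A)
    (h₂ : ∀ v, ∀ w ∈ A, inner ℂ (v - Matrix.toEuclideanLin P v) w = 0) : proj A = P := by
  apply Matrix.toEuclideanLin.injective
  ext1 v
  rw [toEuclideanLin_proj]
  exact (Submodule.eq_starProjection_of_mem_of_inner_eq_zero (h₁ v) (h₂ v))

lemma proj_injective : Function.Injective (proj (n := n)) := by
  intro A B h
  have : A.starProjection = B.starProjection :=
    (Matrix.toEuclideanCLM (n := DIdx n) (𝕜 := ℂ)).symm.injective h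
  ext v
  rw [← Submodule.starProjection_eq_self_iff, this, Submodule.starProjection_eq_self_iff]

lemma star_proj (A : Plane n) : star (proj A) = proj A := by
  apply Matrix.toEuclideanLin.injective
  ext1 v
  refine ext_inner_right ℂ fun w => ?_
  rw [inner_toEuclideanLin, star_star, toEuclideanLin_proj, toEuclideanLin_proj]
  exact (Submodule.starProjection_isSymmetric A v w).symm

lemma proj_mul_proj (A : Plane n) : proj A * proj A = proj A := by
  apply Matrix.toEuclideanLin.injective
  ext1 v
  rw [toEuclideanLin_mul_apply, toEuclideanLin_proj, toEuclideanLin_proj]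
  exact Submodule.starProjection_eq_self_iff.2 (Submodule.starProjection_apply_mem _ _)

lemma proj_compl (A : Plane n) : proj (compl A) = 1 - proj A := by
  apply Matrix.toEuclideanLin.injective
  ext1 v
  rw [toEuclideanLin_proj, map_sub, LinearMap.sub_apply, toEuclideanLin_one_apply,
    toEuclideanLin_proj]
  exact Submodule.starProjection_orthogonal_val v

lemma proj_act (u : UGrp n) (A : Plane n) : proj (act u.1 A) = u.1 * proj A * star u.1 := by
  refine proj_eq_of (fun v => ?_) (fun v w hw => ?_)
  · rw [toEuclideanLin_mul_apply, toEuclideanLin_mul_apply, toEuclideanLin_proj]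
    exact Submodule.mem_map_of_mem (Submodule.starProjection_apply_mem _ _)
  · obtain ⟨w, hw, rfl⟩ := hw
    have h : v = Matrix.toEuclideanLin u.1 (Matrix.toEuclideanLin (star u.1) v) := by
      rw [← toEuclideanLin_mul_apply, Unitary.mul_star_self_of_mem u.2, toEuclideanLin_one_apply]
    rw [toEuclideanLin_mul_apply, toEuclideanLin_mul_apply, toEuclideanLin_proj]
    nth_rw 1 [h]
    rw [← map_sub, inner_toEuclideanLin, ← toEuclideanLin_mul_apply,
      Unitary.star_mul_self_of_mem u.2, toEuclideanLin_one_apply]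
    exact Submodule.starProjection_inner_eq_zero _ _ hw

lemma car_symm (v w : DIdx n → ℂ) : car v w = car w v := by
  simp only [car, carW]
  refine Finset.sum_congr rfl fun e _ => Finset.sum_congr rfl fun i _ => ?_
  ring

lemma carTranspose_carTranspose (X : Op n) : carTranspose (carTranspose X) = X := by
  simp only [carTranspose, Matrix.transpose_mul, gram_transpose, Matrix.transpose_transpose,
    Matrix.mul_assoc, gram_mul_gram, Matrix.mul_one]
  rw [← Matrix.mul_assoc, gram_mul_gram, Matrix.one_mul]

lemma carTranspose_add (X Y : Op n) :
    carTranspose (X + Y) = carTranspose X + carTranspose Y := by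
  simp [carTranspose, Matrix.mul_add, Matrix.add_mul]

lemma carTranspose_smul (c : ℂ) (X : Op n) : carTranspose (c • X) = c • carTranspose X := by
  simp [carTranspose]

lemma carTranspose_neg (X : Op n) : carTranspose (-X) = -carTranspose X := by
  simp [carTranspose]

lemma carTranspose_sub (X Y : Op n) :
    carTranspose (X - Y) = carTranspose X - carTranspose Y := by
  rw [sub_eq_add_neg, carTranspose_add, carTranspose_neg, ← sub_eq_add_neg]

lemma continuous_carTranspose : Continuous (carTranspose (n := n)) := 
  (continuous_const.matrix_mul continuous_id.matrix_transpose).matrix_mul continuous_const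

/-- The real structure: it conjugates the Hermitian product into the bracket. -/
lemma inner_eq_car (v w : DSpace n) :
    inner ℂ v w = car ((gram n).mulVec (star v.ofLp)) w.ofLp := by
  rw [car_symm, car_eq_gram, Matrix.mulVec_mulVec, gram_mul_gram, Matrix.one_mulVec,
    EuclideanSpace.inner_eq_star_dotProduct]

lemma proj_perp (A : Plane n) : proj (perp A) = 1 - carTranspose (proj A) := by
  refine proj_eq_of (fun v w hw => ?_) (fun v w hw => ?_)
  · have hw' : (proj A).mulVec w.ofLp = w.ofLp := by
      have := toEuclideanLin_proj A w
      rw [Submodule.starProjection_eq_self_iff.2 hw] at this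
      exact congrArg WithLp.ofLp this
    have h := car_carTranspose (proj A) v.ofLp w.ofLp
    rw [hw'] at h
    have h2 : (Matrix.toEuclideanLin (1 - carTranspose (proj A)) v).ofLp
        = v.ofLp - (carTranspose (proj A)).mulVec v.ofLp := by
      simp [Matrix.toLpLin_apply]
    rw [h2]
    have h3 : ∀ a b c : DIdx n → ℂ, car (a - b) c = car a c - car b c := by
      intro a b c
      simp only [car_eq_gram, sub_dotProduct]
    rw [h3, h, sub_self]
  · have h1 : v - Matrix.toEuclideanLin (1 - carTranspose (proj A)) v
        = Matrix.toEuclideanLin (carTranspose (proj A)) v := by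
      rw [map_sub, LinearMap.sub_apply, toEuclideanLin_one_apply, sub_sub_cancel]
    rw [h1, inner_toEuclideanLin, star_carTranspose, star_proj, inner_eq_car, car_symm]
    change car ((carTranspose (proj A)).mulVec w.ofLp) _ = 0
    rw [car_carTranspose]
    refine hw (WithLp.toLp 2 ((proj A).mulVec ((gram n).mulVec (star v.ofLp)))) ?_
    have := toEuclideanLin_proj A (WithLp.toLp 2 ((gram n).mulVec (star v.ofLp)))
    have h4 := Submodule.starProjection_apply_mem A (WithLp.toLp 2 ((gram n).mulVec (star v.ofLp)))
    rw [← this] at h4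
    exact h4

/-! ### The operators `J(A)` -/

lemma JOp_eq (A : Plane n) : JOp A = Complex.I • ((2 : ℂ) • proj A - 1) := by
  rw [JOp, proj_compl, two_smul]
  congr 1
  abel

lemma proj_eq_JOp (A : Plane n) : proj A = (2⁻¹ : ℂ) • (1 - Complex.I • JOp A) := by
  rw [JOp_eq, smul_smul, Complex.I_mul_I]
  simp [smul_smul]

lemma JOp_injective : Function.Injective (JOp (n := n)) := fun A B h =>
  proj_injective (by rw [proj_eq_JOp, proj_eq_JOp, h])

lemma isInducing_JOp : Topology.IsInducing (JOp (n := n)) := by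
  have h : Topology.IsInducing (proj (n := n)) := ⟨rfl⟩
  have h1 : Continuous (JOp (n := n)) := by
    have : (JOp (n := n)) = fun A => Complex.I • ((2 : ℂ) • proj A - 1) := funext JOp_eq
    rw [this]
    have := h.continuous
    fun_prop
  refine Topology.IsInducing.of_comp h1
    (g := fun X : Op n => (2⁻¹ : ℂ) • (1 - Complex.I • X)) (by fun_prop) ?_
  have : (fun X : Op n => (2⁻¹ : ℂ) • (1 - Complex.I • X)) ∘ JOp = proj :=
    funext fun A => (proj_eq_JOp A).symm
  rwa [this]

lemma JOp_mul_JOp (A : Plane n) : JOp A * JOp A = -1 := by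
  have := proj_mul_proj A
  simp only [JOp_eq, smul_mul_smul_comm, Complex.I_mul_I, sub_mul, mul_sub, mul_one, one_mul, this]
  simp only [two_smul]
  module

lemma star_JOp (A : Plane n) : star (JOp A) = -JOp A := by
  rw [JOp_eq, star_smul, star_sub, star_smul, star_proj, star_one]
  simp

lemma JOp_act (u : UGrp n) (A : Plane n) : JOp (act u.1 A) = u.1 * JOp A * star u.1 := by
  rw [JOp_eq, JOp_eq, proj_act]
  simp only [mul_smul_comm, smul_mul_assoc, mul_sub, sub_mul, mul_one,
    Unitary.mul_star_self_of_mem u.2]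

lemma JOp_compl (A : Plane n) : JOp (compl A) = -JOp A := by
  rw [JOp_eq, JOp_eq, proj_compl]
  module

lemma JOp_perp (A : Plane n) : JOp (perp A) = -carTranspose (JOp A) := by
  rw [JOp_eq, JOp_eq, proj_perp, carTranspose_smul, carTranspose_sub, carTranspose_smul,
    carTranspose_one]
  module

lemma act_mul (u v : UGrp n) (A : Plane n) : act (u * v).1 A = act u.1 (act v.1 A) := by
  apply JOp_injective
  rw [JOp_act, JOp_act, JOp_act]
  simp [mul_assoc]

lemma act_one (A : Plane n) : act (1 : UGrp n).1 A = A := by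
  apply JOp_injective
  rw [JOp_act]
  simp

lemma act_compl (u : UGrp n) (A : Plane n) : act u.1 (compl A) = compl (act u.1 A) := by
  apply JOp_injective
  simp [JOp_act, JOp_compl]

lemma tauCar_coe (u : UGrp n) : (tauCar n u).1 = carTranspose (star u.1) := rfl

lemma act_tauCar_perp (u : UGrp n) (A : Plane n) :
    act (tauCar n u).1 (perp A) = perp (act u.1 A) := by
  apply JOp_injective
  rw [JOp_act, JOp_perp, JOp_perp, JOp_act]
  simp [carTranspose_mul, tauCar_coe, star_carTranspose, mul_assoc]

lemma genK_mul_genK : (genK n).1 * (genK n).1 = -1 := by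
  simp only [genK, ← Matrix.mul_kronecker_mul, mul_one]
  rw [← neg_one_smul ℂ (1 : Op n), ← Matrix.one_kronecker_one, ← Matrix.smul_kronecker]
  congr 1
  ext a b
  fin_cases a <;> fin_cases b <;> simp [Matrix.mul_apply, Fin.sum_univ_two]

lemma genI_mul_genI : (genI n).1 * (genI n).1 = -1 := by
  simp only [genI, ← Matrix.mul_kronecker_mul, mul_one]
  rw [← neg_one_smul ℂ (1 : Op n), ← Matrix.one_kronecker_one, ← Matrix.smul_kronecker]
  congr 1
  ext a b
  fin_cases a <;> fin_cases b <;> simp [Matrix.mul_apply, Fin.sum_univ_two]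

lemma genK_mul_genI : (genK n).1 * (genI n).1 = -((genI n).1 * (genK n).1) := by
  simp only [genI, genK, ← Matrix.mul_kronecker_mul, mul_one]
  rw [← neg_one_smul ℂ (_ ⊗ₖ _), ← Matrix.smul_kronecker]
  congr 1
  ext a b
  fin_cases a <;> fin_cases b <;> simp [Matrix.mul_apply, Fin.sum_univ_two]

lemma star_genK : star (genK n).1 = -(genK n).1 := by
  simp only [genK, Matrix.star_eq_conjTranspose, Matrix.conjTranspose_kronecker]
  rw [← neg_one_smul ℂ (_ ⊗ₖ _), ← Matrix.smul_kronecker]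
  congr 1
  · ext a b
    fin_cases a <;> fin_cases b <;> simp
  · simp

lemma star_genI : star (genI n).1 = -(genI n).1 := by
  simp only [genI, Matrix.star_eq_conjTranspose, Matrix.conjTranspose_kronecker]
  rw [← neg_one_smul ℂ (_ ⊗ₖ _), ← Matrix.smul_kronecker]
  congr 1
  · ext a b
    fin_cases a <;> fin_cases b <;> simp
  · simp

lemma carTranspose_kronecker (a : Matrix (Fin 2) (Fin 2) ℂ) (b : Matrix (WIdx n) (WIdx n) ℂ) :
    carTranspose (a ⊗ₖ b) =
      a.transpose ⊗ₖ (Matrix.fromBlocks 0 1 1 0 * b.transpose * Matrix.fromBlocks 0 1 1 0) := by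
  rw [carTranspose, gram, ← Matrix.kroneckerMap_transpose, ← Matrix.mul_kronecker_mul,
    ← Matrix.mul_kronecker_mul, one_mul, mul_one]

lemma carTranspose_genK : carTranspose (genK n).1 = (genK n).1 := by
  rw [genK, carTranspose_kronecker]
  congr 1
  · ext a b
    fin_cases a <;> fin_cases b <;> simp
  · simp [Matrix.fromBlocks_multiply, Matrix.fromBlocks_one]

lemma carTranspose_genI : carTranspose (genI n).1 = -(genI n).1 := by
  simp only [genI, carTranspose_kronecker]
  rw [← neg_one_smul ℂ (_ ⊗ₖ _), ← Matrix.smul_kronecker]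
  congr 1
  · ext a b
    fin_cases a <;> fin_cases b <;> simp
  · simp [Matrix.fromBlocks_multiply, Matrix.fromBlocks_one]

lemma proj_eigenspace {X : Op n} (hX : X * X = -1) (hs : star X = -X) {c : ℂ} (hc : c * c = -1)
    (hcs : star c = -c) :
    proj (Module.End.eigenspace (Matrix.toEuclideanLin X) c) = (2⁻¹ : ℂ) • (1 - c • X) := by
  refine proj_eq_of (fun v => ?_) (fun v w hw => ?_)
  · rw [Module.End.mem_eigenspace_iff, ← toEuclideanLin_mul_apply, ← LinearMap.smul_apply,
      ← map_smul]
    congr 2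
    simp only [mul_smul_comm, mul_sub, mul_one, hX, smul_sub, smul_smul]
    rw [mul_left_comm, hc]
    module
  · rw [Module.End.mem_eigenspace_iff] at hw
    have h : v - Matrix.toEuclideanLin ((2⁻¹ : ℂ) • (1 - c • X)) v
        = Matrix.toEuclideanLin ((2⁻¹ : ℂ) • (1 + c • X)) v := by
      nth_rw 1 [← toEuclideanLin_one_apply v]
      rw [← LinearMap.sub_apply, ← map_sub]
      congr 2
      module
    have hcs' : (starRingEnd ℂ) c = -c := hcs
    rw [h, inner_toEuclideanLin]
    simp [hs, hw, hcs', smul_smul, mul_assoc, hc]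

lemma JOp_Eplus : JOp (Eplus n) = (genK n).1 := by
  rw [JOp_eq, Eplus, proj_eigenspace genK_mul_genK star_genK Complex.I_mul_I (by simp)]
  simp [smul_smul]

lemma JOp_Eminus : JOp (Eminus n) = -(genK n).1 := by
  rw [JOp_eq, Eminus, proj_eigenspace genK_mul_genK star_genK (by simp) (by simp)]
  simp [smul_smul]

end Planes

section SquareRoots

section Polar

lemma commute_inverse_of_isUnit {R : Type*} [MonoidWithZero R] {b y : R} (hb : IsUnit b)
    (h : Commute b y) :
    Commute (Ring.inverse b) y := by
  obtain ⟨v, rfl⟩ := hb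
  rw [Ring.inverse_unit]
  exact h.units_inv_left

lemma isUnit_one_add_smul {A : Type*} [CStarAlgebra A] {u : A} (hu : ‖u - 1‖ < 1) {r : ℝ} (h0 : 0 ≤ r) :
    IsUnit (1 + (r : ℂ) • u) := by
  have hr : (0 : ℝ) < 1 + r := by linarith
  have hrc : ((1 + r : ℝ) : ℂ) ≠ 0 := by exact_mod_cast hr.ne'
  have h : 1 + (r : ℂ) • u = ((1 + r : ℝ) : ℂ) • (1 - ((r / (1 + r) : ℝ) : ℂ) • (1 - u)) := by
    rw [smul_sub, smul_smul, ← Complex.ofReal_mul, mul_div_cancel₀ _ hr.ne']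
    push_cast
    module
  rw [h]
  have h2 : ‖((r / (1 + r) : ℝ) : ℂ) • (1 - u)‖ < 1 := by
    rw [norm_smul, Complex.norm_real, norm_sub_rev, Real.norm_of_nonneg (by positivity)]
    have : r / (1 + r) < 1 := by rw [div_lt_one hr]; linarith
    nlinarith [norm_nonneg (u - 1), div_nonneg h0 hr.le]
  exact (isUnit_one_sub_of_norm_lt_one h2).smul (Units.mk0 _ hrc)

variable {A : Type*} [CStarAlgebra A] [PartialOrder A] [StarOrderedRing A]

/-- The unitary factor `x |x|⁻¹` of the polar decomposition of an invertible element. -/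
def polarPart (x : A) : A := x * Ring.inverse (CFC.abs x)

lemma isUnit_abs {x : A} (hx : IsUnit x) : IsUnit (CFC.abs x) := by
  have h : IsUnit (CFC.abs x * CFC.abs x) := by
    rw [CFC.abs_mul_abs]
    exact hx.star.mul hx
  exact ((Commute.refl _).isUnit_mul_iff.1 h).1

lemma star_inverse_abs (x : A) :
    star (Ring.inverse (CFC.abs x)) = Ring.inverse (CFC.abs x) := by
  rw [← Ring.inverse_star, (CFC.abs_nonneg x).isSelfAdjoint.star_eq]

lemma polarPart_mem_unitary {x : A} (hx : IsUnit x) : polarPart x ∈ unitary A := by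
  have hb := isUnit_abs hx
  have h1 : star (polarPart x) * polarPart x = 1 := by
    rw [polarPart, star_mul, star_inverse_abs, mul_assoc, ← mul_assoc (star x),
      ← CFC.abs_mul_abs, mul_assoc, Ring.mul_inverse_cancel _ hb, mul_one,
      Ring.inverse_mul_cancel _ hb]
  have h2 : IsUnit (polarPart x) := hx.mul hb.ringInverse
  refine ⟨h1, ?_⟩
  obtain ⟨v, hv⟩ := h2
  rw [← hv] at h1 ⊢
  rw [← Units.inv_eq_of_mul_eq_one_left h1]
  simp

lemma commute_polarPart {x y : A} (hx : IsUnit x) (h : Commute x y) (h' : Commute x (star y)) :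
    Commute (polarPart x) y :=
  h.mul_left (commute_inverse_of_isUnit (isUnit_abs hx) (h.cfcAbs_left h'))

lemma polarPart_one : polarPart (1 : A) = 1 := by
  simp [polarPart]

lemma polarPart_one_add_mul_self {u : A} (hu : u ∈ unitary A) (h : IsUnit (1 + u)) :
    polarPart (1 + u) * polarPart (1 + u) = u := by
  have hb := isUnit_abs h
  have hn : Commute (1 + u) (star (1 + u)) := by
    rw [star_add, star_one]
    refine ((Commute.one_left _).add_left ((Commute.one_right _).add_right ?_))
    exact (Unitary.mul_star_self_of_mem hu).trans (Unitary.star_mul_self_of_mem hu).symm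
  have hc : Commute (CFC.abs (1 + u)) (1 + u) := (Commute.refl (1 + u)).cfcAbs_left hn
  have hc' := commute_inverse_of_isUnit hb hc
  have h2 : (1 + u) * (1 + u) = u * (CFC.abs (1 + u) * CFC.abs (1 + u)) := by
    rw [CFC.abs_mul_abs, star_add, star_one]
    have := Unitary.mul_star_self_of_mem hu
    simp only [mul_add, add_mul, mul_one, one_mul, ← mul_assoc, this]
    abel
  rw [polarPart, mul_assoc, ← mul_assoc (Ring.inverse _), hc'.eq, mul_assoc, ← mul_assoc, h2]
  simp only [mul_assoc]
  rw [Ring.mul_inverse_cancel_left _ _ hb, Ring.mul_inverse_cancel _ hb, mul_one]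

lemma map_abs (φ : A →+* A) (hφ : ∀ x, φ (star x) = star (φ x)) (x : A) :
    φ (CFC.abs x) = CFC.abs (φ x) := by
  symm
  refine CFC.sqrt_unique ?_ ?_
  · rw [← map_mul, CFC.abs_mul_abs, map_mul, hφ]
  · have h : CFC.abs x = star (CFC.sqrt (CFC.abs x)) * CFC.sqrt (CFC.abs x) := by
      rw [(CFC.sqrt_nonneg _).isSelfAdjoint.star_eq, CFC.sqrt_mul_sqrt_self _ (CFC.abs_nonneg x)]
    rw [h, map_mul, hφ]
    exact star_mul_self_nonneg _

lemma map_polarPart (φ : A →+* A) (hφ : ∀ x, φ (star x) = star (φ x)) {x : A} (hx : IsUnit x)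
    (hn : IsStarNormal x) (h : φ x = star x) : φ (polarPart x) = star (polarPart x) := by
  have hb := isUnit_abs hx
  have h1 : φ (CFC.abs x) = CFC.abs x := by rw [map_abs φ hφ, h, CFC.abs_star x hn]
  have h2 : φ (Ring.inverse (CFC.abs x)) = Ring.inverse (CFC.abs x) := by
    have := congrArg φ (Ring.inverse_mul_cancel _ hb)
    rw [map_mul, h1, map_one] at this
    exact (Ring.eq_mul_inverse_iff_mul_eq _ _ _ hb).2 this |>.trans (one_mul _)
  rw [polarPart, map_mul, h, h2, star_mul, star_inverse_abs]
  refine (commute_inverse_of_isUnit hb ?_).eq.symm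
  exact (hn.star_comm_self.symm).cfcAbs_left (by rw [star_star])

lemma continuousOn_polarPart : ContinuousOn (polarPart (A := A)) {x | IsUnit x} := by
  intro x hx
  refine ContinuousAt.continuousWithinAt ?_
  refine continuousAt_id.mul ?_
  obtain ⟨v, hv⟩ := isUnit_abs hx
  have := NormedRing.inverse_continuousAt v
  rw [hv] at this
  exact this.comp CFC.continuous_abs.continuousAt

end Polar

open scoped Matrix.Norms.L2Operator MatrixOrder ComplexOrder

variable {n : ℕ}

/-- The conjugation `X ↦ (X*)ᵀ` with respect to the real structure given by the bracket. -/
def realConj (n : ℕ) : Op n →+* Op n where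
  toFun X := carTranspose (star X)
  map_one' := by rw [star_one, carTranspose_one]
  map_mul' X Y := by rw [star_mul, carTranspose_mul]
  map_zero' := by simp [carTranspose]
  map_add' X Y := by rw [star_add, carTranspose_add]

lemma realConj_star (X : Op n) : realConj n (star X) = star (realConj n X) :=
  (star_carTranspose (star X)).symm

lemma realConj_smul (r : ℝ) (X : Op n) : realConj n ((r : ℂ) • X) = (r : ℂ) • realConj n X := by
  change carTranspose (star _) = _ • carTranspose _
  rw [star_smul, carTranspose_smul]
  simp

open Classical in
/-- The unitary factors of `1 + r g`: a path from `1` to a square root of `g`. -/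
def sqrtPath (g : UGrp n) (r : unitInterval) : UGrp n :=
  if h : IsUnit (1 + ((r : ℝ) : ℂ) • g.1) then ⟨polarPart _, polarPart_mem_unitary h⟩ else 1

/-- The condition that `g` is close to `h` in operator norm. -/
def Near (g h : UGrp n) : Prop := ‖g.1 - h.1‖ < 1

lemma sqrtPath_coe {g : UGrp n} (hg : Near g 1) (r : unitInterval) :
    (sqrtPath g r).1 = polarPart (1 + ((r : ℝ) : ℂ) • g.1) := by
  rw [sqrtPath, dif_pos (isUnit_one_add_smul hg r.2.1)]

lemma sqrtPath_zero (g : UGrp n) : sqrtPath g 0 = 1 := by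
  have h : IsUnit (1 + (((0 : unitInterval) : ℝ) : ℂ) • g.1) := by simp
  rw [sqrtPath, dif_pos h]
  apply Subtype.ext
  simp [polarPart_one]

lemma sqrtPath_one_mul_self {g : UGrp n} (hg : Near g 1) :
    sqrtPath g 1 * sqrtPath g 1 = g := by
  apply Subtype.ext
  have h := isUnit_one_add_smul hg zero_le_one
  rw [Submonoid.coe_mul, sqrtPath_coe hg]
  simp only [Complex.ofReal_one, one_smul] at h
  simpa using polarPart_one_add_mul_self g.2 h

lemma sqrtPath_commute {g y : UGrp n} (h : Commute g y) (r : unitInterval) :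
    Commute (sqrtPath g r) y := by
  rw [sqrtPath]
  split_ifs with hu
  · have h1 : ∀ z : UGrp n, Commute g z → Commute (1 + ((r : ℝ) : ℂ) • g.1) z.1 := fun z hz =>
      (Commute.one_left _).add_left (Commute.smul_left (congrArg Subtype.val hz.eq) _)
    exact Subtype.ext (commute_polarPart hu (h1 y h) (h1 y⁻¹ h.inv_right)).eq
  · exact Commute.one_left _

lemma tauCar_sqrtPath {g : UGrp n} (h : tauCar n g = g⁻¹) (r : unitInterval) :
    tauCar n (sqrtPath g r) = (sqrtPath g r)⁻¹ := by
  rw [sqrtPath]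
  split_ifs with hu
  · apply Subtype.ext
    have hg : realConj n g.1 = star g.1 := congrArg Subtype.val h
    refine map_polarPart (realConj n) realConj_star hu ⟨?_⟩ ?_
    · have h1 : Commute g.1 (star g.1) :=
        (Unitary.mul_star_self_of_mem g.2).trans (Unitary.star_mul_self_of_mem g.2).symm
      rw [star_add, star_one, star_smul]
      exact (Commute.one_left _).add_left ((Commute.one_right _).add_right
        ((h1.symm.smul_left _).smul_right _))
    · rw [map_add, map_one, realConj_smul, hg]
      simp
  · simp

lemma continuous_sqrtPath {X : Type*} [TopologicalSpace X] {g : X → UGrp n} {r : X → unitInterval}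
    (hg : Continuous g) (hr : Continuous r) (h : ∀ x, Near (g x) 1) :
    Continuous fun x => sqrtPath (g x) (r x) := by
  refine continuous_induced_rng.2 ?_
  refine Continuous.congr ?_ fun x => (sqrtPath_coe (h x) (r x)).symm
  refine continuousOn_polarPart.comp_continuous (s := {x | IsUnit x}) ?_
    fun x => isUnit_one_add_smul (h x) (r x).2.1
  have h1 : Continuous fun x => (g x).1 := continuous_subtype_val.comp hg
  have h2 : Continuous fun x => ((r x : ℝ) : ℂ) :=
    Complex.continuous_ofReal.comp (continuous_subtype_val.comp hr)
  exact continuous_const.add (h2.smul h1)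

lemma Near.mul_mul {g h : UGrp n} (H : Near g h) (a b : UGrp n) : Near (a * g * b) (a * h * b) := by
  have : (a * g * b).1 - (a * h * b).1 = a.1 * (g.1 - h.1) * b.1 := by
    simp [mul_sub, sub_mul]
  rw [Near, this, CStarRing.norm_mul_coe_unitary, CStarRing.norm_coe_unitary_mul]
  exact H

end SquareRoots

section Symmetries

variable {n s : ℕ}

/-! ### The involutions on the unitary group -/

lemma coe_inv_eq_star (u : UGrp n) : (u⁻¹).1 = star u.1 := rfl

lemma commute_genK_mul_genK (u : UGrp n) : Commute (genK n * genK n) u := by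
  apply Subtype.ext
  simp only [Submonoid.coe_mul, genK_mul_genK]
  simp

lemma tauCar_tauCar (u : UGrp n) : tauCar n (tauCar n u) = u := by
  apply Subtype.ext
  rw [tauCar_coe, tauCar_coe, star_carTranspose, star_star, carTranspose_carTranspose]

lemma tauCar_genI : tauCar n (genI n) = genI n := by
  apply Subtype.ext
  rw [tauCar_coe, star_genI, carTranspose_neg, carTranspose_genI, neg_neg]

lemma tauCar_genK : tauCar n (genK n) = (genK n)⁻¹ := by
  apply Subtype.ext
  rw [tauCar_coe, coe_inv_eq_star, star_genK, carTranspose_neg, carTranspose_genK]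

lemma theta_apply (u : UGrp n) :
    theta n u = genI n * genK n * u * (genI n * genK n)⁻¹ := rfl

lemma genI_mul_genK_sq (u : UGrp n) :
    Commute (genI n * genK n * (genI n * genK n)) u := by
  have h : (genI n * genK n * (genI n * genK n)).1 = -1 := by
    simp only [Submonoid.coe_mul]
    rw [mul_assoc, ← mul_assoc (genK n).1, genK_mul_genI, neg_mul, mul_assoc, genK_mul_genK]
    simp [genI_mul_genI]
  apply Subtype.ext
  change (genI n * genK n * (genI n * genK n)).1 * u.1 =
    u.1 * (genI n * genK n * (genI n * genK n)).1
  rw [h]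
  simp

lemma theta_theta (u : UGrp n) : theta n (theta n u) = u := by
  have h := (genI_mul_genK_sq u).eq
  rw [theta_apply, theta_apply]
  calc _ = (genI n * genK n * (genI n * genK n)) * u * (genI n * genK n * (genI n * genK n))⁻¹ := by
        group
    _ = u := by rw [h]; group

lemma theta_tauCar (u : UGrp n) : theta n (tauCar n u) = tauCar n (theta n u) := by
  have h := (commute_genK_mul_genK (tauCar n u)).eq
  rw [theta_apply, theta_apply, map_mul, map_mul, map_inv, map_mul, tauCar_genI, tauCar_genK]
  have h' : genK n * tauCar n u * (genK n)⁻¹ = (genK n)⁻¹ * tauCar n u * genK n := by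
    calc _ = (genK n)⁻¹ * (genK n * genK n * tauCar n u) * (genK n)⁻¹ := by group
      _ = (genK n)⁻¹ * tauCar n u * genK n := by rw [h]; group
  calc _ = genI n * (genK n * tauCar n u * (genK n)⁻¹) * (genI n)⁻¹ := by group
    _ = _ := by rw [h']; group

lemma tauCarTilde_apply (u : UGrp n) : tauCarTilde n u = theta n (tauCar n u) := rfl

lemma genK_conj_genI : genK n * genI n * (genK n)⁻¹ = (genI n)⁻¹ := by
  apply Subtype.ext
  simp only [Submonoid.coe_mul, coe_inv_eq_star, star_genI, star_genK, genK_mul_genI]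
  simp [mul_assoc, genK_mul_genK]

/-- `θ` is conjugation by `K` on operators commuting with `I`. -/
lemma theta_eq_conj_genK {u : UGrp n} (h : Commute (genI n) u) :
    theta n u = genK n * u * (genK n)⁻¹ := by
  have h2 : (genI n)⁻¹ * (genK n * u * (genK n)⁻¹) = genK n * u * (genK n)⁻¹ * (genI n)⁻¹ := by
    rw [← genK_conj_genI]
    calc _ = genK n * (genI n * u) * (genK n)⁻¹ := by group
      _ = genK n * (u * genI n) * (genK n)⁻¹ := by rw [h.eq]
      _ = _ := by group
  have h3 : Commute (genI n) (genK n * u * (genK n)⁻¹) := Commute.inv_left_iff.1 h2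
  calc theta n u = genI n * (genK n * u * (genK n)⁻¹) * (genI n)⁻¹ := by rw [theta_apply]; group
    _ = _ := by rw [h3.eq]; group

lemma theta_eq_self_iff {u : UGrp n} (h : Commute (genI n) u) :
    theta n u = u ↔ Commute (genK n) u := by
  rw [theta_eq_conj_genK h, mul_inv_eq_iff_eq_mul]
  rfl

lemma continuous_tauCar : Continuous (tauCar n) :=
  continuous_induced_rng.2 (continuous_carTranspose.comp
    (continuous_star.comp continuous_subtype_val))

/-! ### Orbits of the eigenspaces of `K` -/

lemma act_inv_act (u : UGrp n) (A : Plane n) : act (u⁻¹).1 (act u.1 A) = A := by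
  rw [← act_mul, inv_mul_cancel, act_one]

lemma act_Eplus_eq_iff {u v : UGrp n} :
    act u.1 (Eplus n) = act v.1 (Eplus n) ↔ Commute (genK n) (u⁻¹ * v) := by
  rw [← JOp_injective.eq_iff, JOp_act, JOp_act, JOp_Eplus]
  have h : u.1 * (genK n).1 * star u.1 = v.1 * (genK n).1 * star v.1 ↔
      u * genK n * u⁻¹ = v * genK n * v⁻¹ := by
    rw [Subtype.ext_iff]; rfl
  rw [h]
  constructor
  · intro h
    calc genK n * (u⁻¹ * v) = u⁻¹ * (u * genK n * u⁻¹) * v := by group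
      _ = u⁻¹ * v * genK n := by rw [h]; group
  · intro h
    calc u * genK n * u⁻¹ = u * (genK n * (u⁻¹ * v)) * v⁻¹ := by group
      _ = v * genK n * v⁻¹ := by rw [h.eq]; group

lemma act_Eplus_eq_self {u : UGrp n} (h : Commute (genK n) u) :
    act u.1 (Eplus n) = Eplus n := by
  have := (act_Eplus_eq_iff (u := (1 : UGrp n)) (v := u)).2 (by simpa using h)
  rw [← this, act_one]

lemma perp_Eplus : perp (Eplus n) = Eminus n := by
  apply JOp_injective
  rw [JOp_perp, JOp_Eplus, JOp_Eminus, carTranspose_genK]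

lemma compl_Eplus : compl (Eplus n) = Eminus n := by
  apply JOp_injective
  rw [JOp_compl, JOp_Eplus, JOp_Eminus]

lemma act_genI_Eplus : act (genI n).1 (Eplus n) = Eminus n := by
  apply JOp_injective
  rw [JOp_act, JOp_Eplus, JOp_Eminus, star_genI, mul_neg, mul_assoc, genK_mul_genI, mul_neg,
    ← mul_assoc, genI_mul_genI]
  simp

lemma act_genI_Eminus : act (genI n).1 (Eminus n) = Eplus n := by
  rw [← act_genI_Eplus, ← act_mul]
  apply JOp_injective
  rw [JOp_act, Submonoid.coe_mul, genI_mul_genI]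
  simp

lemma act_genK_Eminus : act (genK n).1 (Eminus n) = Eminus n := by
  rw [← compl_Eplus, act_compl, act_Eplus_eq_self (Commute.refl _)]

lemma perp_act_Eplus (u : UGrp n) :
    perp (act u.1 (Eplus n)) = act (tauCar n u).1 (Eminus n) := by
  rw [← act_tauCar_perp, perp_Eplus]

lemma tauTilde_act_Eplus (u : UGrp n) :
    tauTilde (act u.1 (Eplus n)) = act (tauCarTilde n u).1 (Eplus n) := by
  rw [tauTilde, perp_act_Eplus, ← act_mul]
  have h : genI n * genK n * tauCar n u = tauCarTilde n u * genI n * genK n := by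
    rw [tauCarTilde_apply, theta_apply]; group
  rw [h, act_mul, act_mul, act_genK_Eminus, act_genI_Eminus]

section Spaces

variable {j : Fin s → Matrix.unitaryGroup (WIdx n) ℂ}

lemma mem_U_iff {u : UGrp n} :
    u ∈ U j ↔ Commute (genI n) u ∧ ∀ l, Commute (genJ j l) u := by
  change (_ = _ ∧ ∀ l, _ = _) ↔ _
  simp only [mul_inv_eq_iff_eq_mul]
  rfl

lemma genK_mul_genJ (l : Fin s) :
    (genK n).1 * (genJ j l).1 = -((genJ j l).1 * (genK n).1) := by
  simp only [genJ, genK, ← Matrix.mul_kronecker_mul, mul_one, one_mul]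
  rw [← neg_one_smul ℂ (_ ⊗ₖ _), ← Matrix.smul_kronecker]
  congr 1
  ext a b
  fin_cases a <;> fin_cases b <;> simp [Matrix.mul_apply, Fin.sum_univ_two]

lemma gramW_mul_gramW : (Matrix.fromBlocks 0 1 1 0 : Matrix (WIdx n) (WIdx n) ℂ) *
    Matrix.fromBlocks 0 1 1 0 = 1 := by
  simp [Matrix.fromBlocks_multiply, Matrix.fromBlocks_one]

lemma carW_eq_dotProduct (ψ φ : WIdx n → ℂ) :
    carW ψ φ = ψ ⬝ᵥ (Matrix.fromBlocks 0 1 1 0 : Matrix (WIdx n) (WIdx n) ℂ).mulVec φ := by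
  simp [carW, dotProduct, Matrix.fromBlocks_mulVec, Finset.sum_add_distrib]

lemma tauCar_genJ (hj : IsRealClifford j) (l : Fin s) : tauCar n (genJ j l) = genJ j l := by
  set G : Matrix (WIdx n) (WIdx n) ℂ := Matrix.fromBlocks 0 1 1 0 with hG
  have h1 : (j l).1.transpose * G * (j l).1 = G := by
    refine Matrix.ext_of_mulVec_single fun b => ?_
    refine dotProduct_eq _ _ fun ψ => ?_
    have := hj.real l ψ (Pi.single b 1)
    rw [carW_eq_dotProduct, carW_eq_dotProduct] at this
    rw [dotProduct_comm, dotProduct_comm _ ψ, ← this, ← Matrix.mulVec_mulVec,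
      ← Matrix.mulVec_mulVec, Matrix.dotProduct_mulVec ψ, Matrix.vecMul_transpose]
  have h2 : G * (j l).1.transpose * G = star (j l).1 := by
    calc G * (j l).1.transpose * G
        = G * ((j l).1.transpose * G * (j l).1) * star (j l).1 := by
          simp only [mul_assoc, Unitary.mul_star_self_of_mem (j l).2, mul_one]
      _ = star (j l).1 := by rw [h1, hG, gramW_mul_gramW, one_mul]
  have h3 : carTranspose (genJ j l).1 = star (genJ j l).1 := by
    rw [genJ, carTranspose_kronecker, ← hG, h2, Matrix.star_eq_conjTranspose,
      Matrix.star_eq_conjTranspose, Matrix.conjTranspose_kronecker]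
    congr 1
    ext a b
    fin_cases a <;> fin_cases b <;> simp
  apply Subtype.ext
  rw [tauCar_coe, ← star_carTranspose, h3, star_star]

lemma tauCar_mem_U (hj : IsRealClifford j) {u : UGrp n} (hu : u ∈ U j) : tauCar n u ∈ U j := by
  rw [mem_U_iff] at hu ⊢
  refine ⟨?_, fun l => ?_⟩
  · have := hu.1.map (tauCar n)
    rwa [tauCar_genI] at this
  · have := (hu.2 l).map (tauCar n)
    rwa [tauCar_genJ hj] at this

lemma act_mem_Cs1 {u : UGrp n} (hu : u ∈ U j) {A : Plane n} (hA : A ∈ Cs1 j) :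
    act u.1 A ∈ Cs1 j := by
  rw [mem_U_iff] at hu
  refine ⟨fun l => ?_, ?_⟩
  · rw [← act_mul, (hu.2 l).eq, act_mul, hA.1 l, act_compl]
  · rw [← act_mul, hu.1.eq, act_mul, hA.2, act_compl]

lemma Eplus_mem_Cs1 : Eplus n ∈ Cs1 j := by
  refine ⟨fun l => ?_, by rw [act_genI_Eplus, compl_Eplus]⟩
  apply JOp_injective
  rw [compl_Eplus, JOp_act, JOp_Eplus, JOp_Eminus]
  have h : (genJ j l).1 * (genK n).1 = -((genK n).1 * (genJ j l).1) := by
    rw [genK_mul_genJ, neg_neg]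
  rw [h, neg_mul, mul_assoc, Unitary.mul_star_self_of_mem (genJ j l).2, mul_one]

lemma RtildeFull_subset_Cs1 : RtildeFull j ⊆ Cs1 j := by
  rintro A ⟨h1, h2, -⟩
  refine ⟨h1, ?_⟩
  rw [act_compl] at h2
  apply JOp_injective
  have := congrArg JOp h2
  rw [JOp_compl] at this
  rw [JOp_compl, ← this, neg_neg]

lemma mem_RtildeFull_of_mem_Cs1 {A : Plane n} (h : A ∈ Cs1 j) (h' : tauTilde A = A) :
    A ∈ RtildeFull j := by
  refine ⟨h.1, ?_, h'⟩
  rw [act_compl, h.2]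
  exact Submodule.orthogonal_orthogonal A

lemma act_Eplus_mem_Cs1 {u : UGrp n} (hu : u ∈ U j) : act u.1 (Eplus n) ∈ Cs1 j :=
  act_mem_Cs1 hu Eplus_mem_Cs1

/-! ### The group of admissible symmetries -/

variable {A₀ : Plane n} {σ : C(C j A₀, U j)}

/-- Elements of `U` commuting with `θ(σ(A))` and `τ̃_car(σ(A))` for all `A ∈ C`. -/
def sectionGroup (σ : C(C j A₀, U j)) : Subgroup (UGrp n) :=
  U j ⊓ Subgroup.centralizer
    (Set.range (fun A => theta n (σ A).1) ∪ Set.range fun A => tauCarTilde n (σ A).1)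

lemma mem_sectionGroup {h : UGrp n} : h ∈ sectionGroup σ ↔
    h ∈ U j ∧ ∀ A, Commute h (theta n (σ A).1) ∧ Commute h (tauCarTilde n (σ A).1) := by
  simp only [sectionGroup, Subgroup.mem_inf, Subgroup.mem_centralizer_iff, Set.mem_union,
    Set.mem_range]
  refine and_congr_right fun _ => ⟨fun H A => ⟨(H _ (Or.inl ⟨A, rfl⟩)).symm,
    (H _ (Or.inr ⟨A, rfl⟩)).symm⟩, ?_⟩
  rintro H _ (⟨A, rfl⟩ | ⟨A, rfl⟩)
  exacts [(H A).1.symm, (H A).2.symm]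

lemma section_mem (hi : SectionCommutes σ) (A : C j A₀) : (σ A).1 ∈ sectionGroup σ :=
  mem_sectionGroup.2 ⟨(σ A).2, fun A' => ⟨(hi A A').1, (hi A A').2.1⟩⟩

lemma tauCar_mem_sectionGroup (hj : IsRealClifford j) {h : UGrp n} (hh : h ∈ sectionGroup σ) :
    tauCar n h ∈ sectionGroup σ := by
  rw [mem_sectionGroup] at hh ⊢
  refine ⟨tauCar_mem_U hj hh.1, fun A => ⟨?_, ?_⟩⟩
  · have := (hh.2 A).2.map (tauCar n)
    rwa [tauCarTilde_apply, ← theta_tauCar, tauCar_tauCar] at this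
  · have := (hh.2 A).1.map (tauCar n)
    rwa [← theta_tauCar] at this

lemma sqrtPath_mem_sectionGroup {h : UGrp n} (hh : h ∈ sectionGroup σ) (r : unitInterval) :
    sqrtPath h r ∈ sectionGroup σ := by
  rw [mem_sectionGroup, mem_U_iff] at hh ⊢
  exact ⟨⟨(sqrtPath_commute hh.1.1.symm r).symm, fun l => (sqrtPath_commute (hh.1.2 l).symm r).symm⟩,
    fun A => ⟨sqrtPath_commute (hh.2 A).1 r, sqrtPath_commute (hh.2 A).2 r⟩⟩

/-- An element of the section group which fixes `E_{+i}(K)` commutes with the section. -/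
lemma commute_section_of_fixed {k : UGrp n} (hk : k ∈ sectionGroup σ) (hK : Commute (genK n) k)
    (A : C j A₀) : Commute k (σ A).1 ∧ Commute k (tauCar n (σ A).1) := by
  have hθ : theta n k = k := (theta_eq_self_iff (mem_U_iff.1 (mem_sectionGroup.1 hk).1).1).2 hK
  have h := (mem_sectionGroup.1 hk).2 A
  refine ⟨?_, ?_⟩
  · have := h.1.map (theta n)
    rwa [hθ, theta_theta] at this
  · have := h.2.map (theta n)
    rwa [hθ, tauCarTilde_apply, theta_theta] at this

lemma commute_genK_tauCar {k : UGrp n} (hK : Commute (genK n) k) : Commute (genK n) (tauCar n k) := by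
  have := hK.map (tauCar n)
  rwa [tauCar_genK, Commute.inv_left_iff] at this

lemma p_eq_act (hσ : IsSection σ) (A : C j A₀) :
    p σ A = act ((tauCar n (σ A).1)⁻¹ * (σ A).1).1 (Eplus n) := by
  rw [act_mul, hσ A]
  rfl

/-- `p (h · E_{+i}(K)) = τ_car(h)⁻¹ h · E_{+i}(K)` for every `h` in the section group. -/
lemma p_act_Eplus (hj : IsRealClifford j) (hσ : IsSection σ) (hi : SectionCommutes σ) {h : UGrp n}
    (hh : h ∈ sectionGroup σ) (A : C j A₀) (hA : A.1 = act h.1 (Eplus n)) :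
    p σ A = act ((tauCar n h)⁻¹ * h).1 (Eplus n) := by
  set u := (σ A).1 with hu
  have hK : Commute (genK n) (u⁻¹ * h) := act_Eplus_eq_iff.1 ((hσ A).trans hA)
  obtain ⟨k, rfl⟩ : ∃ k, h = u * k := ⟨u⁻¹ * h, by group⟩
  rw [inv_mul_cancel_left] at hK
  have hum := section_mem hi A
  have hk : k ∈ sectionGroup σ := by
    have := mul_mem (inv_mem hum) hh
    rwa [inv_mul_cancel_left] at this
  have h1 := commute_section_of_fixed (tauCar_mem_sectionGroup hj hk) (commute_genK_tauCar hK) A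
  rw [p_eq_act hσ, ← hu]
  have h2 : (tauCar n k)⁻¹ * ((tauCar n u)⁻¹ * u) = (tauCar n u)⁻¹ * u * (tauCar n k)⁻¹ :=
    (h1.2.inv_inv.mul_right h1.1.inv_left).eq
  calc act ((tauCar n u)⁻¹ * u).1 (Eplus n)
      = act ((tauCar n u)⁻¹ * u * (tauCar n k)⁻¹).1 (Eplus n) := by
        rw [act_mul ((tauCar n u)⁻¹ * u),
          act_Eplus_eq_self (commute_genK_tauCar hK).inv_right]
    _ = act ((tauCar n (u * k))⁻¹ * (u * k)).1 (Eplus n) := by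
        rw [← h2, ← mul_assoc, ← mul_assoc, act_mul _ k, act_Eplus_eq_self hK, map_mul, mul_inv_rev,
          mul_assoc]

lemma continuous_act {X : Type*} [TopologicalSpace X] {f : X → UGrp n} {g : X → Plane n}
    (hf : Continuous f) (hg : Continuous g) : Continuous fun x => act (f x).1 (g x) := by
  refine isInducing_JOp.continuous_iff.2 ?_
  refine Continuous.congr ?_ fun x => (JOp_act (f x) (g x)).symm
  have h1 : Continuous fun x => (f x).1 := continuous_subtype_val.comp hf
  exact (h1.mul (isInducing_JOp.continuous.comp hg)).mul h1.star

lemma continuous_p (σ : C(C j A₀, U j)) : Continuous (p σ) := by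
  have h : Continuous fun A => (σ A).1 := continuous_subtype_val.comp σ.continuous
  exact continuous_act (continuous_tauCar.comp h).inv continuous_subtype_val

end Spaces

end Symmetries

section Lifting

variable {n : ℕ}

open scoped Matrix.Norms.L2Operator MatrixOrder ComplexOrder in
lemma sqrtPath_one_one : sqrtPath (1 : UGrp n) 1 = 1 := by
  apply Subtype.ext
  have h2 : IsUnit (2 : Op n) := by
    have h : IsUnit (2 : ℂ) := by simp
    have := h.map (algebraMap ℂ (Op n))
    rwa [map_ofNat] at this
  rw [sqrtPath_coe (by simp [Near])]
  have h3 : (1 : Op n) + (((1 : unitInterval) : ℝ) : ℂ) • (1 : UGrp n).1 = 2 := by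
    simp [one_add_one_eq_two]
  rw [h3, polarPart, CFC.abs_ofNat, Ring.mul_inverse_cancel _ h2]
  rfl

/-- Moves `a` to a solution `b` of `τ_car(b)⁻¹ b = q`, provided that `τ_car(a)⁻¹ a` is near `q`. -/
def liftStep (a q : UGrp n) : UGrp n := sqrtPath (tauCar n a * q * a⁻¹) 1 * a

lemma near_liftStep {a q : UGrp n} (h : Near q ((tauCar n a)⁻¹ * a)) :
    Near (tauCar n a * q * a⁻¹) 1 := by
  have := h.mul_mul (tauCar n a) a⁻¹
  rwa [mul_inv_cancel_left, mul_inv_cancel] at this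

lemma tauCar_liftStep_arg {a q : UGrp n} (hq : tauCar n q = q⁻¹) :
    tauCar n (tauCar n a * q * a⁻¹) = (tauCar n a * q * a⁻¹)⁻¹ := by
  rw [map_mul, map_mul, map_inv, tauCar_tauCar, hq]
  group

lemma tauCar_liftStep {a q : UGrp n} (hq : tauCar n q = q⁻¹)
    (h : Near q ((tauCar n a)⁻¹ * a)) :
    (tauCar n (liftStep a q))⁻¹ * liftStep a q = q := by
  rw [liftStep, map_mul, tauCar_sqrtPath (tauCar_liftStep_arg hq), mul_inv_rev, inv_inv]
  calc _ = (tauCar n a)⁻¹ * (sqrtPath (tauCar n a * q * a⁻¹) 1 *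
        sqrtPath (tauCar n a * q * a⁻¹) 1) * a := by simp only [mul_assoc]
    _ = q := by rw [sqrtPath_one_mul_self (near_liftStep h)]; group

lemma liftStep_self {a q : UGrp n} (h : (tauCar n a)⁻¹ * a = q) : liftStep a q = a := by
  subst h
  rw [liftStep, mul_inv_cancel_left, mul_inv_cancel, sqrtPath_one_one, one_mul]

lemma continuous_liftStep {X : Type*} [TopologicalSpace X] {a q : X → UGrp n}
    (ha : Continuous a) (hq : Continuous q) (h : ∀ x, Near (q x) ((tauCar n (a x))⁻¹ * a x)) :
    Continuous fun x => liftStep (a x) (q x) :=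
  (continuous_sqrtPath (((continuous_tauCar.comp ha).mul hq).mul ha.inv) continuous_const
    fun x => near_liftStep (h x)).mul ha

section Lift

variable {M : Type*}

/-- The point reached after `i` steps of size `δ` on the way from `(m, 0)` to `(m, t)`. -/
def stepPoint (δ : M → ℝ) (i : ℕ) (x : M × unitInterval) : M × unitInterval :=
  (x.1, Set.projIcc 0 1 zero_le_one (min (x.2 : ℝ) (i * δ x.1)))

/-- The lift of a family of paths by `i` successive steps. -/
def stepLift (q : M × unitInterval → UGrp n) (δ : M → ℝ) (h₀ : M → UGrp n) :
    ℕ → M × unitInterval → UGrp n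
  | 0, x => h₀ x.1
  | i + 1, x => liftStep (stepLift q δ h₀ i x) (q (stepPoint δ (i + 1) x))

lemma stepPoint_snd {δ : M → ℝ} (hδ : ∀ m, 0 < δ m) (i : ℕ) (x : M × unitInterval) :
    ((stepPoint δ i x).2 : ℝ) = min (x.2 : ℝ) (i * δ x.1) := by
  have h1 : 0 ≤ min (x.2 : ℝ) (i * δ x.1) :=
    le_min x.2.2.1 (mul_nonneg i.cast_nonneg (hδ _).le)
  have h2 : min (x.2 : ℝ) (i * δ x.1) ≤ 1 := (min_le_left _ _).trans x.2.2.2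
  rw [stepPoint, Set.projIcc_of_mem _ ⟨h1, h2⟩]

lemma stepPoint_eq {δ : M → ℝ} (hδ : ∀ m, 0 < δ m) {i : ℕ} {x : M × unitInterval}
    (h : (x.2 : ℝ) ≤ i * δ x.1) : stepPoint δ i x = x :=
  Prod.ext rfl (Subtype.ext ((stepPoint_snd hδ i x).trans (min_eq_left h)))

lemma stepPoint_zero {δ : M → ℝ} (hδ : ∀ m, 0 < δ m) (x : M × unitInterval) :
    stepPoint δ 0 x = (x.1, 0) :=
  Prod.ext rfl (Subtype.ext ((stepPoint_snd hδ 0 x).trans (by simpa using x.2.2.1)))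

lemma near_stepPoint {q : M × unitInterval → UGrp n} {δ : M → ℝ} (hδ : ∀ m, 0 < δ m)
    (h : ∀ m (t t' : unitInterval), |(t : ℝ) - t'| ≤ δ m → Near (q (m, t)) (q (m, t')))
    (i : ℕ) (x : M × unitInterval) :
    Near (q (stepPoint δ (i + 1) x)) (q (stepPoint δ i x)) := by
  refine h x.1 (stepPoint δ (i + 1) x).2 (stepPoint δ i x).2 ?_
  rw [stepPoint_snd hδ, stepPoint_snd hδ]
  refine (abs_min_sub_min_le_max _ _ _ _).trans ?_
  rw [sub_self, abs_zero, max_eq_right (abs_nonneg _)]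
  push_cast
  rw [add_mul, one_mul, add_sub_cancel_left, abs_of_pos (hδ _)]

variable [TopologicalSpace M]

open scoped Matrix.Norms.L2Operator in
/-- A mesh size, depending continuously on the parameter, below which `q` varies little. -/
lemma exists_mesh {q : M × unitInterval → UGrp n} (hq : Continuous q) :
    ∃ δ : M → ℝ, Continuous δ ∧ (∀ m, 0 < δ m) ∧
      ∀ m (t t' : unitInterval), |(t : ℝ) - t'| ≤ δ m → Near (q (m, t)) (q (m, t')) := by
  let f : M → unitInterval × unitInterval → ℝ := fun m x =>
    |(x.1 : ℝ) - x.2| + max (1 - ‖(q (m, x.1)).1 - (q (m, x.2)).1‖) 0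
  have hq' : Continuous fun x => (q x).1 := continuous_subtype_val.comp hq
  have hf : Continuous ↿f := by
    have h1 : Continuous fun x : M × unitInterval × unitInterval => (q (x.1, x.2.1)).1 :=
      hq'.comp (by fun_prop)
    have h2 : Continuous fun x : M × unitInterval × unitInterval => (q (x.1, x.2.2)).1 :=
      hq'.comp (by fun_prop)
    have h3 : Continuous fun x : M × unitInterval × unitInterval => |(x.2.1 : ℝ) - x.2.2| := by
      fun_prop
    exact h3.add ((continuous_const.sub (h1.sub h2).norm).max continuous_const)
  have hK : IsCompact (Set.univ : Set (unitInterval × unitInterval)) := isCompact_univ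
  have hfm : ∀ m, Continuous (f m) := fun m => hf.comp (Continuous.prodMk_right m)
  refine ⟨fun m => sInf (f m '' Set.univ) / 2, (hK.continuous_sInf hf).div_const 2,
    fun m => ?_, fun m t t' h => ?_⟩
  · obtain ⟨x, -, hx, -⟩ := hK.exists_sInf_image_eq_and_le Set.univ_nonempty (hfm m).continuousOn
    have h0 : 0 < f m x := by
      by_cases h : x.1 = x.2
      · have : f m x = 1 := by simp [f, h]
        rw [this]; exact one_pos
      · have : 0 < |(x.1 : ℝ) - x.2| := abs_pos.2 (sub_ne_zero.2 fun h' => h (Subtype.ext h'))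
        exact add_pos_of_pos_of_nonneg this (le_max_right _ _)
    change 0 < sInf _ / 2
    rw [hx]
    exact half_pos h0
  · obtain ⟨x, -, hx, hle⟩ := hK.exists_sInf_image_eq_and_le Set.univ_nonempty (hfm m).continuousOn
    have h1 : sInf (f m '' Set.univ) ≤ f m (t, t') := hx ▸ hle _ (Set.mem_univ _)
    by_contra hn
    have h2 : 1 ≤ ‖(q (m, t)).1 - (q (m, t')).1‖ := not_lt.1 hn
    have h3 : f m (t, t') = |(t : ℝ) - t'| := by
      simp only [f]
      rw [max_eq_right (by linarith), add_zero]
    by_cases htt : t = t'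
    · subst htt
      simp at h2
      linarith
    · have : 0 < |(t : ℝ) - t'| := abs_pos.2 (sub_ne_zero.2 fun h' => htt (Subtype.ext h'))
      simp only at h
      linarith

lemma continuous_stepPoint {δ : M → ℝ} (hδ : Continuous δ) (i : ℕ) :
    Continuous (stepPoint δ i) := by
  unfold stepPoint
  refine continuous_fst.prodMk (continuous_projIcc.comp ?_)
  fun_prop

/-- Lifting of families of paths along `h ↦ τ_car(h)⁻¹ h`, inside a subgroup which is stable under
`τ_car` and under square roots. -/
theorem exists_lift {H : Subgroup (UGrp n)} (hHτ : ∀ h ∈ H, tauCar n h ∈ H)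
    (hHs : ∀ h ∈ H, ∀ r, sqrtPath h r ∈ H) {q : M × unitInterval → UGrp n} (hq : Continuous q)
    (hqτ : ∀ x, tauCar n (q x) = (q x)⁻¹) (hqH : ∀ x, q x ∈ H) {h₀ : M → UGrp n}
    (h₀c : Continuous h₀) (h₀H : ∀ m, h₀ m ∈ H)
    (hstart : ∀ m, (tauCar n (h₀ m))⁻¹ * h₀ m = q (m, 0)) :
    ∃ h : M × unitInterval → UGrp n, Continuous h ∧
      (∀ x, h x ∈ H ∧ (tauCar n (h x))⁻¹ * h x = q x) ∧ ∀ m, h (m, 0) = h₀ m := by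
  obtain ⟨δ, hδc, hδ, hmesh⟩ := exists_mesh hq
  have hnear := near_stepPoint hδ hmesh
  have hsol : ∀ i x, (tauCar n (stepLift q δ h₀ i x))⁻¹ * stepLift q δ h₀ i x
      = q (stepPoint δ i x) := by
    intro i x
    induction i with
    | zero => rw [stepPoint_zero hδ]; exact hstart x.1
    | succ i ih =>
      refine tauCar_liftStep (hqτ _) ?_
      rw [ih]
      exact hnear i x
  have hmem : ∀ i x, stepLift q δ h₀ i x ∈ H := by
    intro i x
    induction i with
    | zero => exact h₀H x.1
    | succ i ih =>
      exact mul_mem (hHs _ (mul_mem (mul_mem (hHτ _ ih) (hqH _)) (inv_mem ih)) 1) ih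
  have hcont : ∀ i, Continuous (stepLift q δ h₀ i) := by
    intro i
    induction i with
    | zero => exact h₀c.comp continuous_fst
    | succ i ih =>
      refine continuous_liftStep ih (hq.comp (continuous_stepPoint hδc (i + 1))) fun x => ?_
      rw [hsol]
      exact hnear i x
  have hstab : ∀ (x : M × unitInterval) (i : ℕ), (x.2 : ℝ) ≤ i * δ x.1 → ∀ k, i ≤ k →
      stepLift q δ h₀ k x = stepLift q δ h₀ i x := by
    intro x i hi k hk
    induction k, hk using Nat.le_induction with
    | base => rfl
    | succ k hk ih =>
      rw [← ih]
      have h1 : (x.2 : ℝ) ≤ k * δ x.1 :=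
        hi.trans (mul_le_mul_of_nonneg_right (by exact_mod_cast hk) (hδ _).le)
      have h2 : (x.2 : ℝ) ≤ (k + 1 : ℕ) * δ x.1 :=
        h1.trans (mul_le_mul_of_nonneg_right (by exact_mod_cast k.le_succ) (hδ _).le)
      refine liftStep_self ?_
      rw [hsol, stepPoint_eq hδ h1, stepPoint_eq hδ h2]
  have hceil : ∀ (x : M × unitInterval) (c : ℝ), 0 < c → c ≤ δ x.1 →
      (x.2 : ℝ) ≤ (⌈1 / c⌉₊ : ℕ) * δ x.1 := by
    intro x c hc hcx
    have h1 : 1 ≤ (⌈1 / c⌉₊ : ℝ) * c := (div_le_iff₀ hc).1 (Nat.le_ceil _)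
    exact x.2.2.2.trans (h1.trans (mul_le_mul_of_nonneg_left hcx (Nat.cast_nonneg _)))
  refine ⟨fun x => stepLift q δ h₀ ⌈1 / δ x.1⌉₊ x, ?_, fun x => ⟨hmem _ _, ?_⟩, fun m => ?_⟩
  · rw [continuous_iff_continuousAt]
    intro x
    have hpos := half_pos (hδ x.1)
    refine ((hcont ⌈1 / (δ x.1 / 2)⌉₊).continuousAt).congr ?_
    have h1 : ∀ᶠ y : M × unitInterval in nhds x, δ x.1 / 2 < δ y.1 :=
      (hδc.comp continuous_fst).continuousAt.eventually_const_lt (half_lt_self (hδ x.1))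
    filter_upwards [h1] with y hy
    exact hstab y _ (hceil y _ (hδ _) le_rfl) _
      (Nat.ceil_mono (one_div_le_one_div_of_le hpos hy.le))
  · rw [hsol, stepPoint_eq hδ (hceil x _ (hδ _) le_rfl)]
  · exact hstab (m, 0) 0 (by simp) _ (Nat.zero_le _)

end Lift

end Lifting

variable {n s : ℕ} {j : Fin s → Matrix.unitaryGroup (WIdx n) ℂ} {A₀ : Plane n}

/-! ### The curves `β_t(A)` -/

lemma JOp_mul_genK {A : Plane n} (hA : act (genK n).1 A = compl A) :
    (genK n).1 * JOp A = -(JOp A * (genK n).1) := by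
  have h := congrArg JOp hA
  rw [JOp_act, JOp_compl] at h
  calc (genK n).1 * JOp A = (genK n).1 * JOp A * star (genK n).1 * (genK n).1 := by
        rw [mul_assoc, Unitary.star_mul_self_of_mem (genK n).2, mul_one]
    _ = _ := by rw [h, neg_mul]

/-- The algebra homomorphism `ℂ → End(ℂ² ⊗ W)` which maps `i` to `K J(A)`. -/
def complexHom {A : Plane n} (hA : act (genK n).1 A = compl A) : ℂ →ₐ[ℝ] Op n :=
  Complex.liftAux ((genK n).1 * JOp A) (by
    nth_rw 1 [JOp_mul_genK hA]
    rw [neg_mul, mul_assoc, ← mul_assoc (genK n).1, genK_mul_genK]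
    simp [JOp_mul_JOp])

section Beta

variable {A : Plane n}

lemma complexHom_apply (hA : act (genK n).1 A = compl A) (z : ℂ) :
    complexHom hA z = (z.re : ℂ) • 1 + (z.im : ℂ) • ((genK n).1 * JOp A) := by
  rw [complexHom, Complex.liftAux_apply, Algebra.algebraMap_eq_smul_one, Complex.coe_smul,
    Complex.coe_smul]

lemma genK_mul_complexHom (hA : act (genK n).1 A = compl A) (z : ℂ) :
    (genK n).1 * complexHom hA z = complexHom hA (star z) * (genK n).1 := by
  have h : JOp A * (genK n).1 = -((genK n).1 * JOp A) := by rw [JOp_mul_genK hA, neg_neg]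
  simp [complexHom_apply, mul_add, add_mul, mul_assoc, h]

lemma star_complexHom (hA : act (genK n).1 A = compl A) (z : ℂ) : star (complexHom hA z) = complexHom hA (star z) := by
  have h : star ((genK n).1 * JOp A) = -((genK n).1 * JOp A) := by
    rw [star_mul, star_JOp, star_genK, neg_mul_neg, JOp_mul_genK hA, neg_neg]
  simp only [complexHom_apply, star_add, star_smul, h, star_one]
  simp

open scoped Matrix.Norms.L2Operator in
lemma exp_smul_genK_mul_JOp (hA : act (genK n).1 A = compl A) (t : ℝ) :
    NormedSpace.exp ((t : ℂ) • ((genK n).1 * JOp A)) =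
      complexHom hA (Complex.exp (t * Complex.I)) := by
  have hc : Continuous (complexHom hA) :=
    LinearMap.continuous_of_finiteDimensional (complexHom hA).toLinearMap
  have h := NormedSpace.map_exp (complexHom hA) hc (t * Complex.I)
  rw [Complex.exp_eq_exp_ℂ, h]
  congr 1
  rw [complexHom_apply]
  simp

lemma JOp_beta (hA : act (genK n).1 A = compl A) (t : ℝ) :
    JOp (beta t A) = complexHom hA (Complex.exp ((t * Real.pi : ℝ) * Complex.I)) * (genK n).1 := by
  set z := Complex.exp ((t * Real.pi / 2 : ℝ) * Complex.I) with hz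
  have hzz : z * star z = 1 := by
    rw [hz, Complex.star_def, ← Complex.exp_conj, ← Complex.exp_add, map_mul, Complex.conj_ofReal,
      Complex.conj_I, mul_neg, add_neg_cancel, Complex.exp_zero]
  have hu : complexHom hA z ∈ Matrix.unitaryGroup (DIdx n) ℂ := by
    refine ⟨?_, ?_⟩
    · rw [star_complexHom, ← map_mul, mul_comm, hzz, map_one]
    · rw [star_complexHom, ← map_mul, hzz, map_one]
  have h := JOp_act ⟨complexHom hA z, hu⟩ (Eplus n)
  rw [beta, exp_smul_genK_mul_JOp hA, ← hz, h]
  simp only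
  rw [JOp_Eplus, star_complexHom, mul_assoc, genK_mul_complexHom, star_star, ← mul_assoc, ← map_mul,
    hz, ← Complex.exp_add]
  congr 3
  push_cast
  ring

lemma JOp_beta' (hA : act (genK n).1 A = compl A) (t : ℝ) : JOp (beta t A) =
    (Real.cos (t * Real.pi) : ℂ) • (genK n).1 + (Real.sin (t * Real.pi) : ℂ) • JOp A := by
  have h : JOp A * (genK n).1 = -((genK n).1 * JOp A) := by rw [JOp_mul_genK hA, neg_neg]
  have h2 : (genK n).1 * JOp A * (genK n).1 = JOp A := by
    rw [mul_assoc, h, mul_neg, ← mul_assoc, genK_mul_genK, neg_one_mul, neg_neg]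
  rw [JOp_beta hA, complexHom_apply, Complex.exp_ofReal_mul_I_re, Complex.exp_ofReal_mul_I_im,
    add_mul, smul_mul_assoc, smul_mul_assoc, one_mul, h2]

lemma continuous_beta (hA : act (genK n).1 A = compl A) : Continuous fun t => beta t A := by
  refine isInducing_JOp.continuous_iff.2 ?_
  refine Continuous.congr ?_ fun t => (JOp_beta' hA t).symm
  fun_prop

lemma beta_half (hA : act (genK n).1 A = compl A) : beta (1 / 2) A = A := by
  apply JOp_injective
  rw [JOp_beta' hA, one_div_mul_eq_div, Real.cos_pi_div_two, Real.sin_pi_div_two]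
  simp

lemma beta_one (hA : act (genK n).1 A = compl A) : beta 1 A = Eminus n := by
  apply JOp_injective
  rw [JOp_beta' hA, one_mul, Real.cos_pi, Real.sin_pi, JOp_Eminus]
  simp

end Beta

/-! ### The components of the base point -/

lemma mem_RtildeFull_iff {A : Plane n} : A ∈ RtildeFull j ↔
    (∀ l, (genJ j l).1 * JOp A * star (genJ j l).1 = -JOp A) ∧
    (genI n).1 * JOp A * star (genI n).1 = -JOp A ∧
    (genI n * genK n).1 * carTranspose (JOp A) * star (genI n * genK n).1 = -JOp A := by
  have h1 : ∀ u : UGrp n, act u.1 A = compl A ↔ u.1 * JOp A * star u.1 = -JOp A := fun u => by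
    rw [← JOp_act, ← JOp_compl, JOp_injective.eq_iff]
  have h2 : tauTilde A = A ↔
      (genI n * genK n).1 * carTranspose (JOp A) * star (genI n * genK n).1 = -JOp A := by
    rw [tauTilde, ← JOp_injective.eq_iff, JOp_act (genI n * genK n), JOp_perp, mul_neg, neg_mul,
      neg_eq_iff_eq_neg]
  rw [← h2, ← h1]
  simp only [← h1]
  exact ⟨fun h => ⟨h.1, (RtildeFull_subset_Cs1 h).2, h.2.2⟩,
    fun h => mem_RtildeFull_of_mem_Cs1 ⟨h.1, h.2.1⟩ h.2.2⟩

lemma Eplus_mem_RtildeFull : Eplus n ∈ RtildeFull j := by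
  refine mem_RtildeFull_of_mem_Cs1 Eplus_mem_Cs1 ?_
  have := tauTilde_act_Eplus (1 : UGrp n)
  rwa [map_one, act_one] at this

lemma Rs11_subset_RtildeFull : Rs11 j ⊆ RtildeFull j := by
  rintro A ⟨⟨h1, h2⟩, h3⟩
  refine mem_RtildeFull_of_mem_Cs1 h1 ?_
  rw [tauTilde, h3]
  rw [act_mul, h2, act_compl, h1.2]
  exact Submodule.orthogonal_orthogonal A

lemma beta_mem_RtildeFull {A : Plane n} (hA : A ∈ Rs11 j) (t : ℝ) : beta t A ∈ RtildeFull j := by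
  have h1 := mem_RtildeFull_iff.1 (Rs11_subset_RtildeFull hA)
  have h2 := mem_RtildeFull_iff.1 (Eplus_mem_RtildeFull (j := j))
  rw [JOp_Eplus] at h2
  rw [mem_RtildeFull_iff, JOp_beta' hA.1.2]
  refine ⟨fun l => ?_, ?_, ?_⟩
  · rw [mul_add, add_mul, mul_smul_comm, mul_smul_comm, smul_mul_assoc, smul_mul_assoc, h1.1 l,
      h2.1 l]
    module
  · rw [mul_add, add_mul, mul_smul_comm, mul_smul_comm, smul_mul_assoc, smul_mul_assoc, h1.2.1,
      h2.2.1]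
    module
  · rw [carTranspose_add, carTranspose_smul, carTranspose_smul, mul_add, add_mul, mul_smul_comm,
      mul_smul_comm, smul_mul_assoc, smul_mul_assoc, h1.2.2, h2.2.2]
    module

lemma R11_subset_Rtilde : R11 j A₀ ⊆ Rtilde j A₀ :=
  connectedComponentIn_mono A₀ Rs11_subset_RtildeFull

lemma Rtilde_subset_C : Rtilde j A₀ ⊆ C j A₀ :=
  connectedComponentIn_mono A₀ RtildeFull_subset_Cs1

lemma beta_mem_Rtilde {A : Plane n} (hA : A ∈ R11 j A₀) (t : ℝ) : beta t A ∈ Rtilde j A₀ := by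
  have hA' : A ∈ Rs11 j := connectedComponentIn_subset _ _ hA
  have h1 : IsPreconnected (Set.range fun t => beta t A) :=
    isPreconnected_range (continuous_beta hA'.1.2)
  have h2 := h1.subset_connectedComponentIn (x := A) (F := RtildeFull j)
    ⟨1 / 2, beta_half hA'.1.2⟩ (by rintro _ ⟨t, rfl⟩; exact beta_mem_RtildeFull hA' t)
  have h3 : Rtilde j A₀ = connectedComponentIn (RtildeFull j) A :=
    connectedComponentIn_eq (R11_subset_Rtilde hA)
  rw [h3]
  exact h2 ⟨t, rfl⟩

lemma base_mem_R11 (hA₀ : A₀ ∈ Rs11 j) : A₀ ∈ R11 j A₀ := mem_connectedComponentIn hA₀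

lemma Eminus_mem_Rtilde (hA₀ : A₀ ∈ Rs11 j) : Eminus n ∈ Rtilde j A₀ := by
  rw [← beta_one hA₀.1.2]
  exact beta_mem_Rtilde (base_mem_R11 hA₀) 1

lemma act_path_mem_C {γ : unitInterval → UGrp n} (hγ : Continuous γ) (hU : ∀ r, γ r ∈ U j)
    (h0 : act (γ 0).1 (Eplus n) ∈ C j A₀) (r : unitInterval) : act (γ r).1 (Eplus n) ∈ C j A₀ := by
  have h1 : IsPreconnected (Set.range fun r => act (γ r).1 (Eplus n)) :=
    isPreconnected_range (continuous_act hγ continuous_const)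
  have h2 := h1.subset_connectedComponentIn (F := Cs1 j) ⟨0, rfl⟩
    (by rintro _ ⟨t, rfl⟩; exact act_Eplus_mem_Cs1 (hU t))
  rw [C, connectedComponentIn_eq h0]
  exact h2 ⟨r, rfl⟩

/-! ### The map `p` -/

variable {σ : C(C j A₀, U j)}

lemma p_of_perp_eq (hσ : IsSection σ) {A : C j A₀} (hA : perp A.1 = A.1) : p σ A = Eminus n := by
  rw [← hσ A, perp_act_Eplus, hσ A] at hA
  have h := act_inv_act (tauCar n (σ A).1) (Eminus n)
  rwa [hA] at h

lemma commute_genI_theta {u : UGrp n} (hu : Commute (genI n) u) : Commute (genI n) (theta n u) := by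
  have h := hu.map (theta n)
  have h2 : theta n (genI n) = (genI n)⁻¹ := by
    rw [theta_apply]
    calc _ = genI n * (genK n * genI n * (genK n)⁻¹) * (genI n)⁻¹ := by group
      _ = _ := by rw [genK_conj_genI]; group
  rwa [h2, Commute.inv_left_iff] at h

lemma p_mem_RtildeFull (hj : IsRealClifford j) (hσ : IsSection σ) (hi : SectionCommutes σ)
    (A : C j A₀) : p σ A ∈ RtildeFull j := by
  set u := (σ A).1 with hu
  set w := (tauCar n u)⁻¹ * u with hw
  have hwG : w ∈ sectionGroup σ :=
    mul_mem (inv_mem (tauCar_mem_sectionGroup hj (section_mem hi A))) (section_mem hi A)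
  have hwU := (mem_sectionGroup.1 hwG).1
  rw [p_eq_act hσ, ← hu, ← hw]
  refine mem_RtildeFull_of_mem_Cs1 (act_Eplus_mem_Cs1 hwU) ?_
  rw [tauTilde_act_Eplus, act_Eplus_eq_iff]
  have h1 : (tauCarTilde n w)⁻¹ = theta n w := by
    rw [tauCarTilde_apply, hw, map_mul, map_inv, tauCar_tauCar, map_mul, map_inv, map_mul, map_inv,
      mul_inv_rev, inv_inv]
  have h2 : Commute w (theta n w) := by
    have := (mem_sectionGroup.1 hwG).2 A
    have h3 : theta n w = (tauCarTilde n u)⁻¹ * theta n u := by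
      rw [hw, map_mul, map_inv, tauCarTilde_apply]
    rw [h3]
    exact this.2.inv_right.mul_right this.1
  have hI := (mem_U_iff.1 hwU).1
  rw [h1, ← theta_eq_self_iff ((commute_genI_theta hI).mul_right hI), map_mul, theta_theta]
  exact h2.eq

lemma p_mem_Rtilde (hj : IsRealClifford j) (hA₀ : A₀ ∈ Rs11 j) (hσ : IsSection σ)
    (hi : SectionCommutes σ) (A : C j A₀) : p σ A ∈ Rtilde j A₀ := by
  have : PreconnectedSpace (C j A₀) :=
    Subtype.preconnectedSpace isPreconnected_connectedComponentIn
  have h0 : A₀ ∈ C j A₀ := Rtilde_subset_C (R11_subset_Rtilde (base_mem_R11 hA₀))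
  have h1 : IsPreconnected (Set.range (p σ)) := isPreconnected_range (continuous_p σ)
  have h2 := h1.subset_connectedComponentIn (x := Eminus n) (F := RtildeFull j)
    ⟨⟨A₀, h0⟩, p_of_perp_eq hσ hA₀.2⟩ (by rintro _ ⟨A, rfl⟩; exact p_mem_RtildeFull hj hσ hi A)
  have h3 : Rtilde j A₀ = connectedComponentIn (RtildeFull j) (Eminus n) :=
    connectedComponentIn_eq (Eminus_mem_Rtilde hA₀)
  rw [h3]
  exact h2 ⟨A, rfl⟩

/-- The value of the section at a plane of `R̃_{s,1}`. -/
def tildeSection (σ : C(C j A₀, U j)) (B : Rtilde j A₀) : UGrp n := (σ ⟨B.1, Rtilde_subset_C B.2⟩).1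

lemma continuous_tildeSection (σ : C(C j A₀, U j)) : Continuous (tildeSection σ) :=
  continuous_subtype_val.comp (σ.continuous.comp (continuous_subtype_val.subtype_mk _))

/-- The element by which `τ_car(σ(A))⁻¹ σ(A)` and the section at `B` differ. -/
def correction (σ : C(C j A₀, U j)) (A : C j A₀) (B : Rtilde j A₀) : UGrp n :=
  (tildeSection σ B)⁻¹ * ((tauCar n (σ A).1)⁻¹ * (σ A).1)

/-- If `p(A) = B`, then the correction turns the section over `R̃_{s,1}` into another one, which
still inverts `τ_car` and which takes the value `τ_car(σ(A))⁻¹ σ(A)` at `B`. -/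
lemma correction_spec (hj : IsRealClifford j) (hσ : IsSection σ) (hi : SectionCommutes σ)
    (hii : SectionInverts σ) {A : C j A₀} {B : Rtilde j A₀} (h : p σ A = B.1) (B' : Rtilde j A₀) :
    tildeSection σ B' * correction σ A B ∈ sectionGroup σ ∧
    tauCar n (tildeSection σ B' * correction σ A B) =
      (tildeSection σ B' * correction σ A B)⁻¹ ∧
    act (tildeSection σ B' * correction σ A B).1 (Eplus n) = B'.1 := by
  set k := correction σ A B with hk
  set u := (σ A).1 with hu
  set g := tildeSection σ B with hg
  set g' := tildeSection σ B' with hg'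
  have hgG : g ∈ sectionGroup σ := section_mem hi _
  have hgG' : g' ∈ sectionGroup σ := section_mem hi _
  have huG : u ∈ sectionGroup σ := section_mem hi A
  have hkG : k ∈ sectionGroup σ :=
    mul_mem (inv_mem hgG) (mul_mem (inv_mem (tauCar_mem_sectionGroup hj huG)) huG)
  have hK : Commute (genK n) k := by
    rw [hk, correction, ← hg, ← hu]
    refine act_Eplus_eq_iff.1 ?_
    rw [← p_eq_act hσ, h]
    exact hσ _
  have hc : Commute k g := (commute_section_of_fixed hkG hK _).1
  have hc' : Commute k g' := (commute_section_of_fixed hkG hK _).1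
  have hτg : tauCar n g = g⁻¹ := hii _ B.2
  have hτg' : tauCar n g' = g'⁻¹ := hii _ B'.2
  have hτk : tauCar n k = k⁻¹ := by
    have h1 : tauCar n k = g * k⁻¹ * g⁻¹ := by
      rw [hk, correction, ← hg, ← hu, map_mul, map_mul, map_inv, map_inv, tauCar_tauCar, hτg]
      group
    rw [h1, ← hc.inv_left.eq]
    group
  refine ⟨mul_mem hgG' hkG, ?_, ?_⟩
  · rw [map_mul, hτg', hτk, ← hc'.eq, mul_inv_rev]
  · rw [act_mul, act_Eplus_eq_self hK]
    exact hσ _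

lemma tildeSection_mul_correction (A : C j A₀) (B : Rtilde j A₀) :
    tildeSection σ B * correction σ A B = (tauCar n (σ A).1)⁻¹ * (σ A).1 :=
  mul_inv_cancel_left _ _

lemma exists_p_eq_of_near (hj : IsRealClifford j) (hσ : IsSection σ) (hi : SectionCommutes σ)
    (hii : SectionInverts σ) {B B' : Rtilde j A₀}
    (hB : Near (tildeSection σ B') (tildeSection σ B)) (h : B.1 ∈ Set.range (p σ)) :
    B'.1 ∈ Set.range (p σ) := by
  obtain ⟨A, hA⟩ := h
  obtain ⟨hq1, hq2, hq3⟩ := correction_spec hj hσ hi hii hA B'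
  set k := correction σ A B with hk
  set u := (σ A).1 with hu
  set q := tildeSection σ B' * k with hq
  have huG : u ∈ sectionGroup σ := section_mem hi A
  have hnear : Near q ((tauCar n u)⁻¹ * u) := by
    rw [hu, ← tildeSection_mul_correction A B, ← hk]
    simpa using hB.mul_mul 1 k
  have hx : tauCar n u * q * u⁻¹ ∈ sectionGroup σ :=
    mul_mem (mul_mem (tauCar_mem_sectionGroup hj huG) hq1) (inv_mem huG)
  have hγ : ∀ r, sqrtPath (tauCar n u * q * u⁻¹) r * u ∈ sectionGroup σ := fun r =>
    mul_mem (sqrtPath_mem_sectionGroup hx r) huG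
  have hγc : Continuous fun r => sqrtPath (tauCar n u * q * u⁻¹) r * u :=
    (continuous_sqrtPath continuous_const continuous_id fun _ => near_liftStep hnear).mul
      continuous_const
  have hmem : act (liftStep u q).1 (Eplus n) ∈ C j A₀ := by
    refine act_path_mem_C hγc (fun r => (mem_sectionGroup.1 (hγ r)).1) ?_ 1
    rw [sqrtPath_zero, one_mul, hu, hσ A]
    exact A.2
  refine ⟨⟨_, hmem⟩, ?_⟩
  rw [p_act_Eplus hj hσ hi (hγ 1) _ rfl]
  change act ((tauCar n (liftStep u q))⁻¹ * liftStep u q).1 _ = _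
  rw [tauCar_liftStep hq2 hnear, hq3]

open scoped Matrix.Norms.L2Operator in
lemma Near.symm {g h : UGrp n} (H : Near g h) : Near h g :=
  (norm_sub_rev h.1 g.1).trans_lt H

open scoped Matrix.Norms.L2Operator in
lemma eventually_near {X : Type*} [TopologicalSpace X] {g : X → UGrp n} (hg : Continuous g)
    (x : X) : ∀ᶠ y in nhds x, Near (g y) (g x) := by
  have h : Continuous fun y => ‖(g y).1 - (g x).1‖ :=
    ((continuous_subtype_val.comp hg).sub continuous_const).norm
  refine h.continuousAt.eventually_lt_const ?_
  simp

lemma Rtilde_subset_range_p (hj : IsRealClifford j) (hA₀ : A₀ ∈ Rs11 j) (hσ : IsSection σ)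
    (hi : SectionCommutes σ) (hii : SectionInverts σ) : Rtilde j A₀ ⊆ Set.range (p σ) := by
  intro B hB
  have : PreconnectedSpace (Rtilde j A₀) :=
    Subtype.preconnectedSpace isPreconnected_connectedComponentIn
  have h := PreconnectedSpace.induction₂' (α := Rtilde j A₀)
    (fun x y => x.1 ∈ Set.range (p σ) → y.1 ∈ Set.range (p σ))
    (fun x => by
      filter_upwards [eventually_near (continuous_tildeSection σ) x] with y hy
      exact ⟨exists_p_eq_of_near hj hσ hi hii hy, exists_p_eq_of_near hj hσ hi hii hy.symm⟩)
    ⟨fun x y z hxy hyz hx => hyz (hxy hx)⟩ ⟨Eminus n, Eminus_mem_Rtilde hA₀⟩ ⟨B, hB⟩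
  exact h ⟨⟨A₀, Rtilde_subset_C (R11_subset_Rtilde (base_mem_R11 hA₀))⟩, p_of_perp_eq hσ hA₀.2⟩

lemma conj_genK_mul_self {u : UGrp n} (hI : Commute (genI n) u) (hc : Commute u (theta n u)) :
    u * u * genK n * (u * u)⁻¹ =
      u * genK n * u⁻¹ * (genK n)⁻¹ * (u * genK n * u⁻¹ * (genK n)⁻¹) * genK n := by
  rw [theta_eq_conj_genK hI] at hc
  have h := hc.inv_right.eq
  calc u * u * genK n * (u * u)⁻¹
      = u * (u * (genK n * u * (genK n)⁻¹)⁻¹) * genK n * u⁻¹ := by group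
    _ = u * ((genK n * u * (genK n)⁻¹)⁻¹ * u) * genK n * u⁻¹ := by rw [h]
    _ = _ := by group

lemma JOp_act_mul_self {u : UGrp n} (hI : Commute (genI n) u) (hc : Commute u (theta n u))
    {Z : Op n} (h : JOp (act u.1 (Eplus n)) = Z * (genK n).1) :
    JOp (act (u * u).1 (Eplus n)) = Z * Z * (genK n).1 := by
  have hZ : (u * genK n * u⁻¹ * (genK n)⁻¹).1 = Z := by
    rw [JOp_act, JOp_Eplus] at h
    simp only [Submonoid.coe_mul, coe_inv_eq_star]
    rw [h, mul_assoc, Unitary.mul_star_self_of_mem (genK n).2, mul_one]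
  have h2 := congrArg Subtype.val (conj_genK_mul_self hI hc)
  rw [Submonoid.coe_mul _ _ (u * u)⁻¹, Submonoid.coe_mul _ _ (genK n), coe_inv_eq_star,
    Submonoid.coe_mul _ _ (genK n), Submonoid.coe_mul _ (u * genK n * u⁻¹ * (genK n)⁻¹), hZ] at h2
  rw [JOp_act, JOp_Eplus, h2]

lemma p_beta (hσ : IsSection σ) (hi : SectionCommutes σ) (hii : SectionInverts σ) {A : Plane n}
    (hA : A ∈ R11 j A₀) (t : ℝ) (h : beta t A ∈ C j A₀) :
    p σ ⟨beta t A, h⟩ = beta (2 * t) A := by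
  have hA' : act (genK n).1 A = compl A := (connectedComponentIn_subset _ _ hA).1.2
  have hτ := hii ⟨beta t A, h⟩ (beta_mem_Rtilde hA t)
  have h1 := (congrArg JOp (hσ ⟨beta t A, h⟩)).trans (JOp_beta hA' t)
  apply JOp_injective
  rw [p_eq_act hσ, hτ, inv_inv, JOp_act_mul_self (mem_U_iff.1 (σ _).2).1 (hi _ _).1 h1,
    JOp_beta hA', ← map_mul, ← Complex.exp_add]
  congr 3
  push_cast
  ring

lemma p_homotopy_lifting (hj : IsRealClifford j) (hσ : IsSection σ) (hi : SectionCommutes σ)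
    (hii : SectionInverts σ) {M : Type*} [TopologicalSpace M]
    (f : C(M × unitInterval, Rtilde j A₀)) (F₀ : C(M, C j A₀))
    (hF₀ : ∀ m, p σ (F₀ m) = (f (m, 0)).1) :
    ∃ F : C(M × unitInterval, C j A₀), (∀ x, p σ (F x) = (f x).1) ∧ ∀ m, F (m, 0) = F₀ m := by
  have hspec := fun x : M × unitInterval => correction_spec hj hσ hi hii (hF₀ x.1) (f x)
  have hu : Continuous fun m => (σ (F₀ m)).1 :=
    continuous_subtype_val.comp (σ.continuous.comp F₀.continuous)
  have hg : Continuous fun x => tildeSection σ (f x) :=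
    (continuous_tildeSection σ).comp f.continuous
  have hk : Continuous fun m => correction σ (F₀ m) (f (m, 0)) :=
    (hg.comp (Continuous.prodMk_left 0)).inv.mul ((continuous_tauCar.comp hu).inv.mul hu)
  obtain ⟨h, hc, hh, h0⟩ := exists_lift (H := sectionGroup σ)
    (fun _ => tauCar_mem_sectionGroup hj) (fun _ => sqrtPath_mem_sectionGroup)
    (q := fun x => tildeSection σ (f x) * correction σ (F₀ x.1) (f (x.1, 0)))
    (hg.mul (hk.comp continuous_fst)) (fun x => (hspec x).2.1) (fun x => (hspec x).1) hu
    (fun m => section_mem hi _) (fun m => (tildeSection_mul_correction _ _).symm)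
  have hstart : ∀ m, act (h (m, 0)).1 (Eplus n) = (F₀ m).1 := fun m => by rw [h0, hσ]
  have hC : ∀ x, act (h x).1 (Eplus n) ∈ C j A₀ := fun x =>
    act_path_mem_C (γ := fun r => h (x.1, r)) (hc.comp (Continuous.prodMk_right x.1))
      (fun r => (mem_sectionGroup.1 (hh (x.1, r)).1).1) (by rw [hstart]; exact (F₀ x.1).2) x.2
  refine ⟨⟨fun x => ⟨_, hC x⟩, (continuous_act hc continuous_const).subtype_mk hC⟩,
    fun x => ?_, fun m => Subtype.ext (hstart m)⟩
  refine (p_act_Eplus hj hσ hi (hh x).1 _ rfl).trans ?_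
  rw [(hh x).2]
  exact (hspec x).2.2

end DiagMap

end
theorem mainTheorem5 {n s : ℕ} (j : Fin s → Matrix.unitaryGroup (DiagMap.WIdx n) ℂ)
    (hj : DiagMap.IsRealClifford j)
    (A₀ : DiagMap.Plane n) (hA₀ : A₀ ∈ DiagMap.Rs11 j)
    (σ : C(DiagMap.C j A₀, DiagMap.U j))
    (hσ : DiagMap.IsSection σ)
    (hi : DiagMap.SectionCommutes σ)
    (hii : DiagMap.SectionInverts σ) :
    -- `p` is a mapping from `C` to `C`
    (∀ A, DiagMap.p σ A ∈ DiagMap.C j A₀) ∧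
    -- 1. `p` is onto `R̃_{s,1}`
    Set.range (DiagMap.p σ) = DiagMap.Rtilde j A₀ ∧
    -- 2. `p (β_t(A)) = β_{2t}(A)` for `A` in `R_{s+1,1}`
    (∀ A ∈ DiagMap.R11 j A₀, ∀ t : ℝ, ∃ h : DiagMap.beta t A ∈ DiagMap.C j A₀,
      DiagMap.p σ ⟨DiagMap.beta t A, h⟩ = DiagMap.beta (2 * t) A) ∧
    -- 3. `p (R_{s+1}) = E_{-i}(K)`
    DiagMap.p σ '' {A | A.1 ∈ DiagMap.R j A₀} = {DiagMap.Eminus n} ∧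
    -- 4. `p` has the homotopy lifting property
    (∀ (M : Type*) [TopologicalSpace M]
      (f : C(M × unitInterval, DiagMap.Rtilde j A₀)) (F₀ : C(M, DiagMap.C j A₀)),
      (∀ m, DiagMap.p σ (F₀ m) = (f (m, 0)).1) →
      ∃ F : C(M × unitInterval, DiagMap.C j A₀),
        (∀ x, DiagMap.p σ (F x) = (f x).1) ∧ ∀ m, F (m, 0) = F₀ m) := by
  have h0 : A₀ ∈ DiagMap.C j A₀ :=
    DiagMap.Rtilde_subset_C (DiagMap.R11_subset_Rtilde (DiagMap.base_mem_R11 hA₀))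
  refine ⟨fun A => DiagMap.Rtilde_subset_C (DiagMap.p_mem_Rtilde hj hA₀ hσ hi A), ?_,
    fun A hA t => ⟨DiagMap.Rtilde_subset_C (DiagMap.beta_mem_Rtilde hA t),
      DiagMap.p_beta hσ hi hii hA t _⟩, ?_,
    fun M _ f F₀ => DiagMap.p_homotopy_lifting hj hσ hi hii f F₀⟩
  · refine Set.Subset.antisymm ?_ (DiagMap.Rtilde_subset_range_p hj hA₀ hσ hi hii)
    rintro _ ⟨A, rfl⟩
    exact DiagMap.p_mem_Rtilde hj hA₀ hσ hi A
  · refine Set.eq_singleton_iff_unique_mem.2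
      ⟨⟨⟨A₀, h0⟩, ⟨⟨hA₀.1.1, hA₀.2⟩, h0⟩, DiagMap.p_of_perp_eq hσ hA₀.2⟩, ?_⟩
    rintro _ ⟨A, hA, rfl⟩
    exact DiagMap.p_of_perp_eq hσ hA.1.2
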